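/- Let $n\ge 1$, $\varepsilon\in\{1,-1\}$, and let $\mathcal A_{2n}=\mathbb C[y_1,\dots,y_{2n}]$, $(y_1,y_2,\dots,y_{2n-1},y_{2n})=(p_1,q_1,\dots,p_n,q_n)$, be the polynomial Weyl algebra with the Moyal product $a\star b=m\circ e^{\frac{\varepsilon}{2}\alpha_{01}}(a\otimes b)$, where $m$ is the ordinary multiplication of polynomials and, on tensor products $a_0\otimes\cdots\otimes a_k$, $\alpha_{rs}=\sum_{j=1}^n\big({}_r\partial_{p_j}\,{}_s\partial_{q_j}-{}_r\partial_{q_j}\,{}_s\partial_{p_j}\big)$, the left index being the tensor factor on which the derivative acts. The sign $\varepsilon$ is the sign convention of the product: $p_j\star q_j-q_j\star p_j=\varepsilon$. For a unital $\mathbb C$-algebra $A$ let $C^k(A,A^*)$ be the space of normalized Hochschild cochains, i.e. multilinear forms $\varphi(a_0,\dots,a_k)$ on $A$ that vanish if one of $a_1,\dots,a_k$ is $1$, and put $$(d\varphi)(a_0,\dots,a_{k+1})=\sum_{i=0}^{k}(-1)^i\varphi(a_0,\dots,a_ia_{i+1},\dots,a_{k+1})+(-1)^{k+1}\varphi(a_{k+1}a_0,a_1,\dots,a_k),$$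 $$(B\varphi)(a_0,\dots,a_k)=\sum_{j=0}^k(-1)^{kj}\varphi(1,a_j,\dots,a_k,a_0,\dots,a_{j-1}),\qquad (\iota_b\varphi)(a_0,\dots,a_k)=\sum_{j=0}^k(-1)^j\varphi(a_0,\dots,a_j,b,a_{j+1},\dots,a_k),$$ the last two for $\varphi\in C^{k+1}(A,A^*)$. For $A=\mathcal A_{2n}$ let $\iota_\omega=\sum_{j=1}^n\iota_{p_j}\iota_{q_j}$ and $L_\omega=[d,\iota_\omega]=d\iota_\omega-\iota_\omega d$. The Feigin–Felder–Shoikhet cochain $\tau_{2n}\in C^{2n}(\mathcal A_{2n},\mathcal A_{2n}^*)$ is $$\tau_{2n}=\mu_{2n}\circ\int_{0=u_0<u_1<\cdots<u_{2n}<1}du_1\cdots du_{2n}\prod_{0\le i<j\le 2n}e^{B_1(u_j-u_i)\alpha_{ji}}\circ\pi_{2n},$$ where $B_1(x)=x-\frac12$, $\pi_{2n}=\det({}_i\partial_{y_l})_{1\le i,l\le 2n}$ acts on the factors $1,\dots,2n$ of $a_0\otimes\cdots\otimes a_{2n}$, and $\mu_{2n}(a_0\otimes\cdots\otimes a_{2n})=a_0(0)\cdots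 a_{2n}(0)$. Set $$I(a_1,\dots,a_{2n})=\mu_{2n}\circ\int_{0=u_1<u_2<\cdots<u_{2n}<1}du_2\cdots du_{2n}\prod_{1\le i<j\le 2n}e^{B_1(u_j-u_i)\alpha_{ji}}\circ\pi_{2n}\,(1\otimes a_1\otimes\cdots\otimes a_{2n}).$$ **Theorem.** For all $a_1,\dots,a_{2n}\in\mathcal A_{2n}$, $$(B\tau_{2n})(a_1,\dots,a_{2n})=I(a_1,\dots,a_{2n}),\qquad (L_\omega\tau_{2n})(a_1,\dots,a_{2n})=-\varepsilon\, I(a_1,\dots,a_{2n}),$$ and hence $(B+\varepsilon L_\omega)\tau_{2n}=0$. Thus for the sign convention $\varepsilon=-1$ of the Moyal product, $B\tau_{2n}=L_\omega\tau_{2n}=I$ and $(B-L_\omega)\tau_{2n}=0$; for $\varepsilon=1$ the same holds with $\iota_\omega$ replaced by $-\iota_\omega=\sum_j\iota_{q_j}\iota_{p_j}$ (and $L_\omega$ accordingly). -/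

import Mathlib

/-! ## Normalized Hochschild cochains of a unital algebra with values in the dual bimodule -/

/-- `C^k(A, A^*) = Hom(Ā^{⊗ k}, A^*)` with `Ā = A / ℂ·1`: multilinear forms
`φ(a_0, a_1, …, a_k)` (the slot `a_0` is the argument of the functional in `A^*`) that vanish as
soon as one of `a_1, …, a_k` is the unit. The bimodule structure of `A^*` is
`(a · f · b)(c) = f(b c a)`. -/
def NormCochain (A : Type*) [Ring A] [Algebra ℂ A] (k : ℕ) :
    Submodule ℂ (MultilinearMap ℂ (fun _ : Fin (k + 1) => A) ℂ) where
  carrier := {φ | ∀ a : Fin (k + 1) → A, ∀ i, i ≠ 0 → a i = 1 → φ a = 0}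
  add_mem' := fun hφ hψ a i hi ha => by simp [hφ a i hi ha, hψ a i hi ha]
  zero_mem' := fun _ _ _ _ => rfl
  smul_mem' := fun c φ hφ a i hi ha => by simp [hφ a i hi ha]

/-- Precomposition of multilinear forms with a map `F` of tuples that is affected by each entry of
its argument in one slot only, and linearly there. -/
def pullTuple {A : Type*} [Ring A] [Algebra ℂ A] {k m : ℕ} (F : (Fin k → A) → (Fin m → A))
    (hF : ∀ (a : Fin k → A) (j : Fin k), ∃ (l : Fin m) (T : A →ₗ[ℂ] A),
      ∀ x, F (Function.update a j x) = Function.update (F a) l (T x)) :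
    MultilinearMap ℂ (fun _ : Fin m => A) ℂ →ₗ[ℂ] MultilinearMap ℂ (fun _ : Fin k => A) ℂ where
  toFun φ := MultilinearMap.mk' (fun a => φ (F a))
    (fun a j x y => by obtain ⟨l, T, h⟩ := hF a j; simp [h])
    (fun a j c x => by obtain ⟨l, T, h⟩ := hF a j; simp [h])
  map_add' _ _ := rfl
  map_smul' _ _ := rfl

theorem pullTuple_apply {A : Type*} [Ring A] [Algebra ℂ A] {k m : ℕ}
    (F : (Fin k → A) → (Fin m → A))
    (hF : ∀ (a : Fin k → A) (j : Fin k), ∃ (l : Fin m) (T : A →ₗ[ℂ] A),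
      ∀ x, F (Function.update a j x) = Function.update (F a) l (T x))
    (φ : MultilinearMap ℂ (fun _ : Fin m => A) ℂ) (a : Fin k → A) :
    pullTuple F hF φ a = φ (F a) := rfl

/-- `(a_0, …, a_i a_{i+1}, …, a_{k+1})`. -/
def mulFace {A : Type*} [Ring A] {k : ℕ} (i : Fin (k + 1)) (a : Fin (k + 2) → A) :
    Fin (k + 1) → A :=
  Fin.contractNth i.castSucc (· * ·) a

/-- `(a_{k+1} a_0, a_1, …, a_k)`. -/
def wrapFace {A : Type*} [Ring A] {k : ℕ} (a : Fin (k + 2) → A) : Fin (k + 1) → A :=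
  Fin.cons (a (Fin.last (k + 1)) * a 0) (fun l : Fin k => a l.succ.castSucc)

/-- `(a_0, …, a_j, b, a_{j+1}, …, a_k)`. -/
def insertAfter {A : Type*} {k : ℕ} (b : A) (j : Fin (k + 1)) (a : Fin (k + 1) → A) :
    Fin (k + 2) → A :=
  Fin.insertNth (α := fun _ => A) j.succ b a

/-- `(1, a_j, a_{j+1}, …, a_k, a_0, …, a_{j-1})`. -/
def unitRotate {A : Type*} [Ring A] {k : ℕ} (j : Fin (k + 1)) (a : Fin (k + 1) → A) :
    Fin (k + 2) → A :=
  Fin.cons 1 (fun i => a (j + i))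

theorem mulFace_update {A : Type*} [Ring A] [Algebra ℂ A] {k : ℕ} (i : Fin (k + 1))
    (a : Fin (k + 2) → A) (j : Fin (k + 2)) : ∃ (l : Fin (k + 1)) (T : A →ₗ[ℂ] A),
      ∀ x, mulFace i (Function.update a j x) = Function.update (mulFace i a) l (T x) := by
  rcases lt_trichotomy (j : ℕ) i with h | h | h
  · refine ⟨⟨j, by omega⟩, LinearMap.id, fun x => ?_⟩
    funext l
    simp only [mulFace, Fin.contractNth, Function.update_apply, Fin.ext_iff]
    simp
    grind
  · refine ⟨i, LinearMap.mulRight ℂ (a i.succ), fun x => ?_⟩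
    funext l
    simp only [mulFace, Fin.contractNth, Function.update_apply, Fin.ext_iff]
    simp
    grind
  · by_cases h' : (j : ℕ) = i + 1
    · refine ⟨i, LinearMap.mulLeft ℂ (a i.castSucc), fun x => ?_⟩
      funext l
      simp only [mulFace, Fin.contractNth, Function.update_apply, Fin.ext_iff]
      simp
      grind
    · refine ⟨⟨j - 1, by omega⟩, LinearMap.id, fun x => ?_⟩
      funext l
      simp only [mulFace, Fin.contractNth, Function.update_apply, Fin.ext_iff]
      simp
      grind

theorem wrapFace_update {A : Type*} [Ring A] [Algebra ℂ A] {k : ℕ}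
    (a : Fin (k + 2) → A) (j : Fin (k + 2)) : ∃ (l : Fin (k + 1)) (T : A →ₗ[ℂ] A),
      ∀ x, wrapFace (Function.update a j x) = Function.update (wrapFace a) l (T x) := by
  by_cases h0 : j = 0
  · subst h0
    refine ⟨0, LinearMap.mulLeft ℂ (a (Fin.last (k + 1))), fun x => ?_⟩
    funext l
    refine Fin.cases ?_ (fun l => ?_) l <;>
      simp [wrapFace, Fin.ext_iff]
  · by_cases h1 : j = Fin.last (k + 1)
    · subst h1
      refine ⟨0, LinearMap.mulRight ℂ (a 0), fun x => ?_⟩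
      funext l
      refine Fin.cases ?_ (fun l => ?_) l
      · simp [wrapFace, Function.update_apply, Fin.ext_iff]
      · have : ¬ ((l : ℕ) + 1 = k + 1) := by omega
        simp [wrapFace, Function.update_apply, Fin.ext_iff]
        omega
    · have hj0 : (j : ℕ) ≠ 0 := fun h => h0 (Fin.ext h)
      have hj1 : (j : ℕ) ≠ k + 1 := fun h => h1 (Fin.ext h)
      refine ⟨⟨j, by omega⟩, LinearMap.id, fun x => ?_⟩
      funext l
      refine Fin.cases ?_ (fun l => ?_) l
      · simp [wrapFace, Function.update_apply, Fin.ext_iff]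
        grind
      · simp [wrapFace, Function.update_apply, Fin.ext_iff]

theorem insertAfter_update {A : Type*} [Ring A] [Algebra ℂ A] {k : ℕ} (b : A) (i : Fin (k + 1))
    (a : Fin (k + 1) → A) (j : Fin (k + 1)) : ∃ (l : Fin (k + 2)) (T : A →ₗ[ℂ] A),
      ∀ x, insertAfter b i (Function.update a j x)
        = Function.update (insertAfter b i a) l (T x) :=
  ⟨i.succ.succAbove j, LinearMap.id, fun x => by
    simp only [insertAfter, LinearMap.id_apply]
    exact Fin.insertNth_update (α := fun _ => A) i.succ b j x a⟩

theorem unitRotate_update {A : Type*} [Ring A] [Algebra ℂ A] {k : ℕ} (i : Fin (k + 1))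
    (a : Fin (k + 1) → A) (j : Fin (k + 1)) : ∃ (l : Fin (k + 2)) (T : A →ₗ[ℂ] A),
      ∀ x, unitRotate i (Function.update a j x) = Function.update (unitRotate i a) l (T x) := by
  refine ⟨(j - i).succ, LinearMap.id, fun x => ?_⟩
  rw [unitRotate, unitRotate, ← Fin.cons_update]
  congr 1
  funext l
  simp only [Function.update_apply, LinearMap.id_apply]
  have : i + l = j ↔ l = j - i := by rw [eq_sub_iff_add_eq, add_comm l i]
  simp [this]

/-- The Hochschild differential `d : C^k(A, A^*) → C^{k+1}(A, A^*)` on all multilinear forms. -/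
def hochschildForm {A : Type*} [Ring A] [Algebra ℂ A] (k : ℕ) :
    MultilinearMap ℂ (fun _ : Fin (k + 1) => A) ℂ →ₗ[ℂ]
      MultilinearMap ℂ (fun _ : Fin (k + 2) => A) ℂ :=
  ∑ i : Fin (k + 1), (-1 : ℂ) ^ (i : ℕ) • pullTuple (mulFace i) (mulFace_update i)
    + (-1 : ℂ) ^ (k + 1) • pullTuple wrapFace wrapFace_update

theorem hochschildForm_apply {A : Type*} [Ring A] [Algebra ℂ A] {k : ℕ}
    (φ : MultilinearMap ℂ (fun _ : Fin (k + 1) => A) ℂ) (a : Fin (k + 2) → A) :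
    hochschildForm k φ a = ∑ i : Fin (k + 1), (-1 : ℂ) ^ (i : ℕ) * φ (mulFace i a)
      + (-1 : ℂ) ^ (k + 1) * φ (wrapFace a) := by
  simp [hochschildForm, pullTuple_apply]

theorem hochschildForm_mem {A : Type*} [Ring A] [Algebra ℂ A] {k : ℕ}
    (φ : MultilinearMap ℂ (fun _ : Fin (k + 1) => A) ℂ) (hφ : φ ∈ NormCochain A k) :
    hochschildForm k φ ∈ NormCochain A (k + 1) := by
  intro a s hs has
  have hs0 : (s : ℕ) ≠ 0 := fun h => hs (Fin.ext h)
  rw [hochschildForm_apply]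
  have hvan : ∀ i : Fin (k + 1), (i : ℕ) ≠ s → (i : ℕ) + 1 ≠ s → φ (mulFace i a) = 0 := by
    intro i h1 h2
    rcases lt_or_gt_of_ne h1 with h | h
    · refine hφ _ ⟨s - 1, by omega⟩ (by rw [Ne, Fin.ext_iff]; simp only [Fin.val_zero]; omega) ?_
      rw [mulFace, Fin.contractNth_apply_of_gt _ _ _ _ (by simp; omega)]
      rw [← has]; congr 1; ext; simp; omega
    · refine hφ _ ⟨s, by omega⟩ (by rw [Ne, Fin.ext_iff]; simp only [Fin.val_zero]; omega) ?_
      rw [mulFace, Fin.contractNth_apply_of_lt _ _ _ _ (by simp; omega)]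
      rw [← has]; rfl
  by_cases hl : (s : ℕ) = k + 1
  · have hsl : s = Fin.last (k + 1) := Fin.ext hl
    rw [Finset.sum_eq_single (Fin.last k)
      (fun i _ hi => by
        have : (i : ℕ) ≠ k := fun h => hi (Fin.ext h)
        rw [hvan i (by omega) (by omega), mul_zero]) (by simp)]
    have : mulFace (Fin.last k) a = wrapFace a := by
      funext l
      refine Fin.cases ?_ (fun l => ?_) l
      · by_cases hk : k = 0
        · subst hk
          rw [mulFace, Fin.contractNth_apply_of_eq _ _ _ _ (by simp)]
          subst hsl
          have e : a 1 = 1 := has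
          simp [wrapFace, e]
        · rw [mulFace, Fin.contractNth_apply_of_lt _ _ _ _ (by simp; omega)]
          subst hsl
          simp [wrapFace, has]
      · by_cases hk : (l : ℕ) + 1 = k
        · rw [mulFace, Fin.contractNth_apply_of_eq _ _ _ _ (by simp [hk])]
          have e : l.succ.succ = s := Fin.ext (by simp [hl, hk])
          simp [wrapFace, e, has]
        · rw [mulFace, Fin.contractNth_apply_of_lt _ _ _ _ (by simp; omega)]
          simp [wrapFace]
    rw [this]
    simp [pow_succ]
  · have hw : φ (wrapFace a) = 0 := by
      refine hφ _ ⟨s, by omega⟩ (by rw [Ne, Fin.ext_iff]; simp only [Fin.val_zero]; omega) ?_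
      have e : (⟨s, by omega⟩ : Fin (k + 1)) = Fin.succ ⟨s - 1, by omega⟩ :=
        Fin.ext (by simp; omega)
      rw [e, wrapFace, Fin.cons_succ, ← has]
      congr 1; ext; simp; omega
    rw [hw, mul_zero, add_zero]
    rw [Finset.sum_eq_add (⟨s - 1, by omega⟩ : Fin (k + 1)) ⟨s, by omega⟩
      (by simp [Fin.ext_iff]; omega)
      (fun i _ hi => by
        have h1 : (i : ℕ) ≠ s - 1 := fun h => hi.1 (Fin.ext h)
        have h2 : (i : ℕ) ≠ s := fun h => hi.2 (Fin.ext h)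
        rw [hvan i h2 (by omega), mul_zero]) (by simp) (by simp)]
    have : mulFace ⟨s - 1, by omega⟩ a = mulFace ⟨s, by omega⟩ a := by
      funext l
      simp only [mulFace, Fin.contractNth]
      simp only [Fin.castSucc_mk]
      rcases lt_trichotomy (l : ℕ) (s - 1) with h | h | h
      · have : (l : ℕ) < s := by omega
        simp [h, this]
      · have h2 : (l : ℕ) < s := by omega
        have e : l.succ = s := Fin.ext (by simp; omega)
        have h3 : ¬ (l : ℕ) < s - 1 := by omega
        simp [h, e, has]
        intro h9; exact absurd h9 hs
      · have h3 : ¬ (l : ℕ) < s - 1 := by omega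
        have h4 : ¬ (l : ℕ) = s - 1 := by omega
        have h5 : ¬ (l : ℕ) < s := by omega
        by_cases h6 : (l : ℕ) = s
        · have e : l.castSucc = s := Fin.ext h6
          have h7 : ¬ (s : ℕ) < s - 1 := by omega
          have h8 : ¬ (s : ℕ) = s - 1 := by omega
          simp [h6, e, has, h7, h8]
        · simp [h3, h4, h5, h6]
    rw [this]
    obtain ⟨t, ht⟩ : ∃ t, (s : ℕ) = t + 1 := ⟨s - 1, by omega⟩
    simp [ht, pow_succ]

/-- The Hochschild differential `d : C^k(A, A^*) → C^{k+1}(A, A^*)`,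
`(dφ)(a_0, …, a_{k+1}) = ∑_{i=0}^{k} (-1)^i φ(a_0, …, a_i a_{i+1}, …, a_{k+1})
  + (-1)^{k+1} φ(a_{k+1} a_0, a_1, …, a_k)`. -/
def hochschildD {A : Type*} [Ring A] [Algebra ℂ A] (k : ℕ) :
    NormCochain A k →ₗ[ℂ] NormCochain A (k + 1) :=
  (hochschildForm k).restrict hochschildForm_mem

/-- The interior product on all multilinear forms. -/
def interiorForm {A : Type*} [Ring A] [Algebra ℂ A] (k : ℕ) (b : A) :
    MultilinearMap ℂ (fun _ : Fin (k + 2) => A) ℂ →ₗ[ℂ]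
      MultilinearMap ℂ (fun _ : Fin (k + 1) => A) ℂ :=
  ∑ j : Fin (k + 1), (-1 : ℂ) ^ (j : ℕ) • pullTuple (insertAfter b j) (insertAfter_update b j)

theorem interiorForm_mem {A : Type*} [Ring A] [Algebra ℂ A] {k : ℕ} (b : A)
    (φ : MultilinearMap ℂ (fun _ : Fin (k + 2) => A) ℂ) (hφ : φ ∈ NormCochain A (k + 1)) :
    interiorForm k b φ ∈ NormCochain A k := by
  intro a s hs has
  simp only [interiorForm, LinearMap.sum_apply, LinearMap.smul_apply, FunLike.coe_sum,
    Finset.sum_apply, FunLike.coe_smul, Pi.smul_apply, pullTuple_apply]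
  refine Finset.sum_eq_zero fun j _ => ?_
  have : φ (insertAfter b j a) = 0 := by
    refine hφ _ (j.succ.succAbove s) ?_ ?_
    · exact Fin.succAbove_ne_zero (Fin.succ_ne_zero j) hs
    · simp [insertAfter, has]
  simp [this]

/-- The interior product `ι_b : C^{k+1}(A, A^*) → C^k(A, A^*)`,
`(ι_b φ)(a_0, …, a_k) = ∑_{j=0}^{k} (-1)^j φ(a_0, …, a_j, b, a_{j+1}, …, a_k)`. -/
def hochInterior {A : Type*} [Ring A] [Algebra ℂ A] (k : ℕ) (b : A) :
    NormCochain A (k + 1) →ₗ[ℂ] NormCochain A k :=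
  (interiorForm k b).restrict (interiorForm_mem b)

/-- The Connes operator on all multilinear forms. -/
def connesForm {A : Type*} [Ring A] [Algebra ℂ A] (k : ℕ) :
    MultilinearMap ℂ (fun _ : Fin (k + 2) => A) ℂ →ₗ[ℂ]
      MultilinearMap ℂ (fun _ : Fin (k + 1) => A) ℂ :=
  ∑ j : Fin (k + 1), (-1 : ℂ) ^ (k * (j : ℕ)) • pullTuple (unitRotate j) (unitRotate_update j)

theorem connesForm_mem {A : Type*} [Ring A] [Algebra ℂ A] {k : ℕ}
    (φ : MultilinearMap ℂ (fun _ : Fin (k + 2) => A) ℂ) (hφ : φ ∈ NormCochain A (k + 1)) :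
    connesForm k φ ∈ NormCochain A k := by
  intro a s hs has
  simp only [connesForm, LinearMap.sum_apply, LinearMap.smul_apply, FunLike.coe_sum,
    Finset.sum_apply, FunLike.coe_smul, Pi.smul_apply, pullTuple_apply]
  refine Finset.sum_eq_zero fun j _ => ?_
  have : φ (unitRotate j a) = 0 := by
    refine hφ _ (s - j).succ (Fin.succ_ne_zero _) ?_
    simp [unitRotate, has]
  simp [this]

/-- The Connes differential `B : C^{k+1}(A, A^*) → C^k(A, A^*)`,
`(Bφ)(a_0, …, a_k) = ∑_{j=0}^{k} (-1)^{kj} φ(1, a_j, a_{j+1}, …, a_k, a_0, …, a_{j-1})`. -/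
def connesB {A : Type*} [Ring A] [Algebra ℂ A] (k : ℕ) :
    NormCochain A (k + 1) →ₗ[ℂ] NormCochain A k :=
  (connesForm k).restrict connesForm_mem

/-! ## Tensor powers of the polynomial algebra and exponentials of differential operators -/

/-- Position of `p_{j+1}` among the coordinates `(y_1, …, y_{2n}) = (p_1, q_1, …, p_n, q_n)`,
which are indexed from `0`. -/
def pIdx {n : ℕ} (j : Fin n) : Fin (2 * n) := ⟨2 * j, by omega⟩

/-- Position of `q_{j+1}` among the coordinates `(y_1, …, y_{2n}) = (p_1, q_1, …, p_n, q_n)`,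
which are indexed from `0`. -/
def qIdx {n : ℕ} (j : Fin n) : Fin (2 * n) := ⟨2 * j + 1, by omega⟩

/-- The `m`-fold tensor power of `ℂ[y_1, …, y_{2n}]`, as the polynomial ring in `m` sets of
variables, one for each tensor factor. -/
abbrev TensorPoly (m n : ℕ) : Type := MvPolynomial (Fin m × Fin (2 * n)) ℂ

/-- `a_0 ⊗ a_1 ⊗ ⋯ ⊗ a_{m-1}`. -/
noncomputable def pureTensor (m n : ℕ) :
    MultilinearMap ℂ (fun _ : Fin m => MvPolynomial (Fin (2 * n)) ℂ) (TensorPoly m n) :=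
  (MultilinearMap.mkPiAlgebra ℂ (Fin m) (TensorPoly m n)).compLinearMap
    (fun i => (MvPolynomial.rename (Prod.mk i)).toLinearMap)

/-- The partial derivative with respect to the coordinate `x`, applied to the factor `r`. -/
noncomputable def slotDeriv {m n : ℕ} (r : Fin m) (x : Fin (2 * n)) :
    Module.End ℂ (TensorPoly m n) :=
  (MvPolynomial.pderiv (R := ℂ) (r, x)).toLinearMap

/-- `α_{rs} = ∑_j (_r∂_{p_j} _s∂_{q_j} - _r∂_{q_j} _s∂_{p_j})`. -/
noncomputable def alphaOp {m n : ℕ} (r s : Fin m) : Module.End ℂ (TensorPoly m n) :=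
  ∑ j : Fin n, (slotDeriv r (pIdx j) * slotDeriv s (qIdx j)
    - slotDeriv r (qIdx j) * slotDeriv s (pIdx j))

/-- All monomials of the polynomial have degree `< d`. -/
def DegLT {σ : Type*} (d : ℕ) (f : MvPolynomial σ ℂ) : Prop :=
  ∀ s : σ →₀ ℕ, d ≤ s.degree → MvPolynomial.coeff s f = 0

/-- The operator lowers the degree of polynomials. -/
def LowersDegree {σ : Type*} (D : Module.End ℂ (MvPolynomial σ ℂ)) : Prop :=
  ∀ (d : ℕ) (f : MvPolynomial σ ℂ), DegLT (d + 1) f → DegLT d (D f)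

theorem DegLT.mono {σ : Type*} {d e : ℕ} {f : MvPolynomial σ ℂ} (h : DegLT d f) (hde : d ≤ e) :
    DegLT e f := fun s hs => h s (hde.trans hs)

theorem DegLT.eq_zero {σ : Type*} {f : MvPolynomial σ ℂ} (h : DegLT 0 f) : f = 0 := by
  ext s; simpa using h s (Nat.zero_le _)

theorem exists_degLT {σ : Type*} (f : MvPolynomial σ ℂ) : ∃ d, DegLT d f := by
  refine ⟨f.support.sup Finsupp.degree + 1, fun s hs => ?_⟩
  by_contra hne
  have : s.degree ≤ f.support.sup Finsupp.degree :=
    Finset.le_sup (f := Finsupp.degree) (MvPolynomial.mem_support_iff.2 hne)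
  omega

theorem LowersDegree.pow {σ : Type*} {D : Module.End ℂ (MvPolynomial σ ℂ)} (hD : LowersDegree D)
    {d : ℕ} {f : MvPolynomial σ ℂ} (hf : DegLT d f) (k : ℕ) (hk : d ≤ k) : (D ^ k) f = 0 := by
  have key : ∀ (k e : ℕ) (g : MvPolynomial σ ℂ), DegLT (e + k) g → DegLT e ((D ^ k) g) := by
    intro k
    induction k with
    | zero => intro e g hg; simpa using hg
    | succ k ih =>
      intro e g hg
      rw [pow_succ, Module.End.mul_apply]
      exact ih e _ (hD _ _ (by rwa [← add_assoc] at hg))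
  exact (key k 0 f (hf.mono (by omega))).eq_zero

theorem LowersDegree.add {σ : Type*} {D E : Module.End ℂ (MvPolynomial σ ℂ)}
    (hD : LowersDegree D) (hE : LowersDegree E) : LowersDegree (D + E) := by
  intro d f hf s hs
  simp [hD d f hf s hs, hE d f hf s hs]

theorem LowersDegree.smul {σ : Type*} {D : Module.End ℂ (MvPolynomial σ ℂ)}
    (hD : LowersDegree D) (c : ℂ) : LowersDegree (c • D) := by
  intro d f hf s hs
  simp [hD d f hf s hs]

theorem LowersDegree.sum {σ ι : Type*} (t : Finset ι) {D : ι → Module.End ℂ (MvPolynomial σ ℂ)}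
    (hD : ∀ i, LowersDegree (D i)) : LowersDegree (∑ i ∈ t, D i) := by
  intro d f hf s hs
  simp only [LinearMap.sum_apply, MvPolynomial.coeff_sum]
  exact Finset.sum_eq_zero fun i _ => hD i d f hf s hs

theorem LowersDegree.mul {σ : Type*} {D E : Module.End ℂ (MvPolynomial σ ℂ)}
    (hD : LowersDegree D) (hE : LowersDegree E) : LowersDegree (D * E) := by
  intro d f hf
  rw [Module.End.mul_apply]
  exact hD _ _ ((hE _ _ hf).mono (Nat.le_succ d))

theorem lowersDegree_slotDeriv {m n : ℕ} (r : Fin m) (x : Fin (2 * n)) :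
    LowersDegree (slotDeriv r x) := by
  intro d f hf s hs
  simp only [slotDeriv, Derivation.coeFn_coe, MvPolynomial.coeff_pderiv]
  rw [hf _ (by simp [map_add]; exact hs), zero_mul]

theorem lowersDegree_alphaOp {m n : ℕ} (r s : Fin m) :
    LowersDegree (alphaOp (n := n) r s) := by
  refine LowersDegree.sum _ fun j => ?_
  rw [sub_eq_add_neg, ← neg_one_smul ℂ]
  exact ((lowersDegree_slotDeriv _ _).mul (lowersDegree_slotDeriv _ _)).add
    (((lowersDegree_slotDeriv _ _).mul (lowersDegree_slotDeriv _ _)).smul _)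

/-- `e^D f = ∑_k D^k f / k!`, a finite sum if `D` lowers degrees. -/
noncomputable def expFun {σ : Type*} (D : Module.End ℂ (MvPolynomial σ ℂ)) (f : MvPolynomial σ ℂ) :
    MvPolynomial σ ℂ :=
  ∑ᶠ k : ℕ, ((Nat.factorial k : ℂ)⁻¹) • (D ^ k) f

theorem expFun_eq_sum {σ : Type*} {D : Module.End ℂ (MvPolynomial σ ℂ)} (hD : LowersDegree D)
    {d : ℕ} {f : MvPolynomial σ ℂ} (hf : DegLT d f) :
    expFun D f = ∑ k ∈ Finset.range d, ((Nat.factorial k : ℂ)⁻¹) • (D ^ k) f := by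
  refine finsum_eq_finsetSum_of_support_subset _ fun k hk => ?_
  by_contra hkd
  simp only [Finset.coe_range, Set.mem_Iio, not_lt] at hkd
  exact hk (by simp [hD.pow hf k hkd])

/-- The exponential of an operator that lowers degrees. -/
noncomputable def expOp {σ : Type*} (D : Module.End ℂ (MvPolynomial σ ℂ)) (hD : LowersDegree D) :
    Module.End ℂ (MvPolynomial σ ℂ) where
  toFun := expFun D
  map_add' f g := by
    obtain ⟨d, hf⟩ := exists_degLT f
    obtain ⟨e, hg⟩ := exists_degLT g
    have hf' := hf.mono (le_max_left d e)
    have hg' := hg.mono (le_max_right d e)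
    have hfg : DegLT (max d e) (f + g) := fun s hs => by simp [hf' s hs, hg' s hs]
    rw [expFun_eq_sum hD hf', expFun_eq_sum hD hg', expFun_eq_sum hD hfg,
      ← Finset.sum_add_distrib]
    simp
  map_smul' c f := by
    obtain ⟨d, hf⟩ := exists_degLT f
    have hcf : DegLT d (c • f) := fun s hs => by simp [hf s hs]
    rw [expFun_eq_sum hD hf, expFun_eq_sum hD hcf, RingHom.id_apply, Finset.smul_sum]
    exact Finset.sum_congr rfl fun k _ => by rw [map_smul, smul_comm]

theorem expOp_eq_sum {σ : Type*} {D : Module.End ℂ (MvPolynomial σ ℂ)} (hD : LowersDegree D)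
    {d : ℕ} {f : MvPolynomial σ ℂ} (hf : DegLT d f) :
    expOp D hD f = ∑ k ∈ Finset.range d, ((Nat.factorial k : ℂ)⁻¹) • (D ^ k) f :=
  expFun_eq_sum hD hf

theorem expOp_of_apply_eq_zero {σ : Type*} {D : Module.End ℂ (MvPolynomial σ ℂ)}
    (hD : LowersDegree D) {f : MvPolynomial σ ℂ} (hf : D f = 0) : expOp D hD f = f := by
  obtain ⟨d, hd⟩ := exists_degLT f
  rw [expOp_eq_sum hD (hd.mono (Nat.le_succ d)), Finset.sum_range_succ', Finset.sum_eq_zero]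
  · simp
  · intro k _
    rw [pow_succ, Module.End.mul_apply, hf]
    simp

theorem expOp_comm {σ : Type*} {D T : Module.End ℂ (MvPolynomial σ ℂ)}
    (hD : LowersDegree D) (h : Commute D T) (f : MvPolynomial σ ℂ) :
    expOp D hD (T f) = T (expOp D hD f) := by
  obtain ⟨d, hd⟩ := exists_degLT f
  obtain ⟨e, he⟩ := exists_degLT (T f)
  rw [expOp_eq_sum hD (hd.mono (le_max_left d e)), expOp_eq_sum hD (he.mono (le_max_right d e)),
    map_sum]
  refine Finset.sum_congr rfl fun k _ => ?_
  rw [map_smul]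
  congr 1
  exact LinearMap.congr_fun (h.pow_left k).eq f

theorem expOp_derivation {σ : Type*} {D T δ : Module.End ℂ (MvPolynomial σ ℂ)}
    (hD : LowersDegree D) (h : D * T = T * D + δ) (hδ : Commute D δ) (f : MvPolynomial σ ℂ) :
    expOp D hD (T f) = T (expOp D hD f) + δ (expOp D hD f) := by
  obtain ⟨d, hd⟩ := exists_degLT f
  obtain ⟨e, he⟩ := exists_degLT (T f)
  have hpow : ∀ k : ℕ, D ^ (k + 1) * T = T * D ^ (k + 1) + ((k + 1 : ℕ) : ℂ) • (δ * D ^ k) := by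
    intro k
    induction k with
    | zero => simp [h]
    | succ k ih =>
      rw [pow_succ' D (k + 1), mul_assoc, ih, mul_add, ← mul_assoc, h, mul_smul_comm,
        ← mul_assoc D δ, hδ.eq, mul_assoc δ D, ← pow_succ', add_mul, mul_assoc T, add_assoc,
        ← pow_succ' D (k + 1)]
      congr 1
      push_cast
      module
  have e1 := expOp_eq_sum hD (he.mono ((le_max_right d e).trans (Nat.le_succ _)))
  have e2 := expOp_eq_sum hD (hd.mono ((le_max_left d e).trans (Nat.le_succ (max d e))))
  have e3 := expOp_eq_sum hD (hd.mono (le_max_left d e))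
  have step : expOp D hD (T f) = T (expOp D hD f)
      + δ (∑ k ∈ Finset.range (max d e), ((Nat.factorial k : ℂ)⁻¹) • (D ^ k) f) := by
    rw [e1, e2, map_sum, map_sum, Finset.sum_range_succ', Finset.sum_range_succ', add_assoc,
      add_comm _ (∑ k ∈ Finset.range (max d e), δ _), ← add_assoc, ← Finset.sum_add_distrib]
    congr 1
    · refine Finset.sum_congr rfl fun k _ => ?_
      have := LinearMap.congr_fun (hpow k) f
      simp only [Module.End.mul_apply, LinearMap.add_apply, LinearMap.smul_apply] at this
      rw [this, smul_add, map_smul, map_smul, smul_smul]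
      congr 2
      rw [Nat.factorial_succ]
      have h1 : ((k + 1 : ℕ) : ℂ) ≠ 0 := by exact_mod_cast Nat.succ_ne_zero k
      have h2 : ((Nat.factorial k : ℕ) : ℂ) ≠ 0 := by exact_mod_cast Nat.factorial_ne_zero k
      push_cast at h1 ⊢
      field_simp
    · simp
  rw [step, ← e3]

/-! ## The Weyl algebra -/

/-- `a(y) ⊗ b(y) ↦ a(y) b(y)`. -/
noncomputable def diagMul (n : ℕ) : TensorPoly 2 n →ₐ[ℂ] MvPolynomial (Fin (2 * n)) ℂ :=
  MvPolynomial.rename Prod.snd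

theorem lowersDegree_moyal (n : ℕ) (ε : ℤˣ) :
    LowersDegree ((((ε : ℤ) : ℂ) / 2) • alphaOp (m := 2) (n := n) 0 1) :=
  (lowersDegree_alphaOp 0 1).smul _

/-- The Moyal product `a ⋆ b = m (e^{(ε/2) α_{01}} (a ⊗ b))`, where the sign `ε` is the sign
convention of the product: `p_j ⋆ q_j - q_j ⋆ p_j = ε`. -/
noncomputable def moyal (n : ℕ) (ε : ℤˣ) (a b : MvPolynomial (Fin (2 * n)) ℂ) :
    MvPolynomial (Fin (2 * n)) ℂ :=
  diagMul n (expOp ((((ε : ℤ) : ℂ) / 2) • alphaOp 0 1) (lowersDegree_moyal n ε)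
    (pureTensor 2 n ![a, b]))

theorem pureTensor_two {n : ℕ} (a b : MvPolynomial (Fin (2 * n)) ℂ) :
    pureTensor 2 n ![a, b]
      = MvPolynomial.rename (Prod.mk 0) a * MvPolynomial.rename (Prod.mk 1) b := by
  simp [pureTensor]

theorem slotDeriv_rename_of_ne {m n : ℕ} {r s : Fin m} (h : r ≠ s) (x : Fin (2 * n))
    (a : MvPolynomial (Fin (2 * n)) ℂ) :
    slotDeriv r x (MvPolynomial.rename (Prod.mk s) a) = 0 := by
  simp only [slotDeriv, Derivation.coeFn_coe]
  induction a using MvPolynomial.induction_on with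
  | C c => simp
  | add f g hf hg => simp [hf, hg]
  | mul_X f i hf =>
    have : ((s, i) : Fin m × Fin (2 * n)) ≠ (r, x) :=
      fun e => h (congrArg Prod.fst e).symm
    simp [Derivation.leibniz, hf, MvPolynomial.pderiv_X_of_ne this]

theorem slotDeriv_mul {m n : ℕ} (r : Fin m) (x : Fin (2 * n)) (f g : TensorPoly m n) :
    slotDeriv r x (f * g) = slotDeriv r x f * g + f * slotDeriv r x g :=
  MvPolynomial.pderiv_mul

theorem slotDeriv_comm {m n : ℕ} (r s : Fin m) (x y : Fin (2 * n)) :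
    Commute (slotDeriv (m := m) r x) (slotDeriv s y) := by
  classical
  refine LinearMap.ext fun f => ?_
  simp only [slotDeriv, Module.End.mul_apply, Derivation.coeFn_coe]
  ext t
  simp only [MvPolynomial.coeff_pderiv, Finsupp.add_apply, Finsupp.single_apply]
  rw [add_right_comm]
  by_cases h : ((r, x) : Fin m × Fin (2 * n)) = (s, y)
  · rw [h]
  · rw [if_neg h, if_neg (fun e => h e.symm)]
    push_cast
    ring

theorem alphaOp_comm_slotDeriv {m n : ℕ} (r s t : Fin m) (x : Fin (2 * n)) :
    Commute (alphaOp (n := n) r s) (slotDeriv t x) := by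
  unfold alphaOp
  refine Commute.sum_left _ _ _ fun j _ => ?_
  have h1 : Commute (slotDeriv r (pIdx j) * slotDeriv s (qIdx j)) (slotDeriv t x) :=
    (slotDeriv_comm r t (pIdx j) x).mul_left (slotDeriv_comm s t (qIdx j) x)
  have h2 : Commute (slotDeriv r (qIdx j) * slotDeriv s (pIdx j)) (slotDeriv t x) :=
    (slotDeriv_comm r t (qIdx j) x).mul_left (slotDeriv_comm s t (pIdx j) x)
  exact h1.sub_left h2

theorem alphaOp_pureTensor_one_left {n : ℕ} (b : MvPolynomial (Fin (2 * n)) ℂ) :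
    alphaOp 0 1 (pureTensor 2 n ![1, b]) = 0 := by
  rw [pureTensor_two, map_one, one_mul]
  simp only [alphaOp, LinearMap.sum_apply, LinearMap.sub_apply]
  refine Finset.sum_eq_zero fun j _ => ?_
  rw [(slotDeriv_comm 0 1 (pIdx j) (qIdx j)).eq, (slotDeriv_comm 0 1 (qIdx j) (pIdx j)).eq]
  simp [slotDeriv_rename_of_ne (show (0 : Fin 2) ≠ 1 by decide)]

theorem alphaOp_pureTensor_one_right {n : ℕ} (a : MvPolynomial (Fin (2 * n)) ℂ) :
    alphaOp 0 1 (pureTensor 2 n ![a, 1]) = 0 := by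
  rw [pureTensor_two, map_one, mul_one]
  simp only [alphaOp, LinearMap.sum_apply, LinearMap.sub_apply]
  refine Finset.sum_eq_zero fun j _ => ?_
  simp [slotDeriv_rename_of_ne (show (1 : Fin 2) ≠ 0 by decide)]

theorem moyal_one_left {n : ℕ} (ε : ℤˣ) (b : MvPolynomial (Fin (2 * n)) ℂ) :
    moyal n ε 1 b = b := by
  rw [moyal, expOp_of_apply_eq_zero _ (by
    rw [LinearMap.smul_apply, alphaOp_pureTensor_one_left, smul_zero]), pureTensor_two]
  rw [map_one, diagMul]
  simp only [one_mul, MvPolynomial.rename_rename]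
  exact MvPolynomial.rename_id_apply _

theorem moyal_one_right {n : ℕ} (ε : ℤˣ) (a : MvPolynomial (Fin (2 * n)) ℂ) :
    moyal n ε a 1 = a := by
  rw [moyal, expOp_of_apply_eq_zero _ (by
    rw [LinearMap.smul_apply, alphaOp_pureTensor_one_right, smul_zero]), pureTensor_two]
  rw [map_one, diagMul]
  simp only [mul_one, MvPolynomial.rename_rename]
  exact MvPolynomial.rename_id_apply _

theorem moyal_add_left {n : ℕ} (ε : ℤˣ) (a b c : MvPolynomial (Fin (2 * n)) ℂ) :
    moyal n ε (a + b) c = moyal n ε a c + moyal n ε b c := by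
  simp [moyal, pureTensor_two, add_mul]

theorem moyal_add_right {n : ℕ} (ε : ℤˣ) (a b c : MvPolynomial (Fin (2 * n)) ℂ) :
    moyal n ε a (b + c) = moyal n ε a b + moyal n ε a c := by
  simp [moyal, pureTensor_two, mul_add]

theorem moyal_smul_left {n : ℕ} (ε : ℤˣ) (t : ℂ) (a b : MvPolynomial (Fin (2 * n)) ℂ) :
    moyal n ε (t • a) b = t • moyal n ε a b := by
  simp [moyal, pureTensor_two]

theorem moyal_smul_right {n : ℕ} (ε : ℤˣ) (t : ℂ) (a b : MvPolynomial (Fin (2 * n)) ℂ) :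
    moyal n ε a (t • b) = t • moyal n ε a b := by
  simp [moyal, pureTensor_two]

/-- `∑_j (∂_{p_j} y_x) _r∂_{q_j} - (∂_{q_j} y_x) _r∂_{p_j}`. -/
noncomputable def hamSlot {m n : ℕ} (x : Fin (2 * n)) (r : Fin m) :
    Module.End ℂ (TensorPoly m n) :=
  ∑ j : Fin n, ((if x = pIdx j then (1 : ℂ) else 0) • slotDeriv r (qIdx j)
    - (if x = qIdx j then (1 : ℂ) else 0) • slotDeriv r (pIdx j))

/-- `{y_x, f}`. -/
noncomputable def ham {n : ℕ} (x : Fin (2 * n)) (f : MvPolynomial (Fin (2 * n)) ℂ) :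
    MvPolynomial (Fin (2 * n)) ℂ :=
  ∑ j : Fin n, ((if x = pIdx j then (1 : ℂ) else 0) • MvPolynomial.pderiv (qIdx j) f
    - (if x = qIdx j then (1 : ℂ) else 0) • MvPolynomial.pderiv (pIdx j) f)

theorem slotDeriv_mulLeft_X {m n : ℕ} (r : Fin m) (z x : Fin (2 * n)) :
    slotDeriv r z * LinearMap.mulLeft ℂ (MvPolynomial.X (r, x) : TensorPoly m n)
      = LinearMap.mulLeft ℂ (MvPolynomial.X (r, x)) * slotDeriv r z
        + (if x = z then (1 : ℂ) else 0) • 1 := by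
  refine LinearMap.ext fun f => ?_
  simp only [Module.End.mul_apply, LinearMap.mulLeft_apply, slotDeriv_mul, LinearMap.add_apply]
  by_cases h : x = z
  · subst h; simp [slotDeriv]; ring
  · have : ((r, x) : Fin m × Fin (2 * n)) ≠ (r, z) := fun e => h (congrArg Prod.snd e)
    simp [slotDeriv, MvPolynomial.pderiv_X_of_ne this, h]

theorem slotDeriv_mulLeft_X_of_ne {m n : ℕ} {r s : Fin m} (hrs : r ≠ s) (z x : Fin (2 * n)) :
    slotDeriv s z * LinearMap.mulLeft ℂ (MvPolynomial.X (r, x) : TensorPoly m n)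
      = LinearMap.mulLeft ℂ (MvPolynomial.X (r, x)) * slotDeriv s z := by
  refine LinearMap.ext fun f => ?_
  have : ((r, x) : Fin m × Fin (2 * n)) ≠ (s, z) := fun e => hrs (congrArg Prod.fst e)
  simp [Module.End.mul_apply, slotDeriv_mul]
  simp [slotDeriv, MvPolynomial.pderiv_X_of_ne this]

theorem alphaOp_mulLeft_X {m n : ℕ} {r s : Fin m} (hrs : r ≠ s) (x : Fin (2 * n)) :
    alphaOp r s * LinearMap.mulLeft ℂ (MvPolynomial.X (r, x) : TensorPoly m n)
      = LinearMap.mulLeft ℂ (MvPolynomial.X (r, x)) * alphaOp r s + hamSlot x s := by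
  simp only [alphaOp, hamSlot, Finset.sum_mul, Finset.mul_sum, ← Finset.sum_add_distrib]
  refine Finset.sum_congr rfl fun j _ => ?_
  rw [sub_mul, mul_sub, mul_assoc, mul_assoc, slotDeriv_mulLeft_X_of_ne hrs,
    slotDeriv_mulLeft_X_of_ne hrs, ← mul_assoc, ← mul_assoc, slotDeriv_mulLeft_X,
    slotDeriv_mulLeft_X, add_mul, add_mul, mul_assoc, mul_assoc, smul_mul_assoc, smul_mul_assoc,
    one_mul, one_mul]
  abel

theorem alphaOp_comm_hamSlot {m n : ℕ} (r s t : Fin m) (x : Fin (2 * n)) :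
    Commute (alphaOp r s) (hamSlot x t) := by
  unfold hamSlot
  refine Commute.sum_right _ _ _ fun j _ => ?_
  have h1 := (alphaOp_comm_slotDeriv r s t (qIdx j)).smul_right (if x = pIdx j then (1 : ℂ) else 0)
  have h2 := (alphaOp_comm_slotDeriv r s t (pIdx j)).smul_right (if x = qIdx j then (1 : ℂ) else 0)
  exact h1.sub_right h2

theorem pderiv_diagMul {n : ℕ} (x : Fin (2 * n)) (w : TensorPoly 2 n) :
    MvPolynomial.pderiv x (diagMul n w)
      = diagMul n (slotDeriv 0 x w) + diagMul n (slotDeriv 1 x w) := by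
  simp only [slotDeriv, Derivation.coeFn_coe, diagMul]
  induction w using MvPolynomial.induction_on with
  | C c => simp
  | add f g hf hg => simp only [map_add, hf, hg]; abel
  | mul_X f i hf =>
    classical
    obtain ⟨r, y⟩ := i
    simp only [map_mul, Derivation.leibniz, hf, MvPolynomial.rename_X, MvPolynomial.pderiv_X,
      Pi.single_apply, smul_eq_mul, map_add, Prod.mk.injEq]
    fin_cases r <;> by_cases h : y = x <;> simp [h] <;> ring

theorem ham_diagMul {n : ℕ} (x : Fin (2 * n)) (w : TensorPoly 2 n) :
    ham x (diagMul n w) = diagMul n (hamSlot x 0 w) + diagMul n (hamSlot x 1 w) := by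
  simp only [ham, hamSlot, LinearMap.sum_apply, map_sum, ← Finset.sum_add_distrib]
  refine Finset.sum_congr rfl fun j _ => ?_
  simp only [pderiv_diagMul, LinearMap.sub_apply, LinearMap.smul_apply, map_sub, map_smul]
  module

theorem slotDeriv_zero_pureTensor {n : ℕ} (x : Fin (2 * n)) (a b : MvPolynomial (Fin (2 * n)) ℂ) :
    slotDeriv 0 x (pureTensor 2 n ![a, b]) = pureTensor 2 n ![MvPolynomial.pderiv x a, b] := by
  rw [pureTensor_two, pureTensor_two, slotDeriv_mul,
    slotDeriv_rename_of_ne (show (0 : Fin 2) ≠ 1 by decide), mul_zero, add_zero]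
  congr 1
  exact MvPolynomial.pderiv_rename (f := Prod.mk (0 : Fin 2)) (fun _ _ h => (Prod.mk.inj h).2) x a

theorem hamSlot_zero_pureTensor {n : ℕ} (x : Fin (2 * n)) (a b : MvPolynomial (Fin (2 * n)) ℂ) :
    hamSlot x 0 (pureTensor 2 n ![a, b]) = pureTensor 2 n ![ham x a, b] := by
  simp only [hamSlot, ham, LinearMap.sum_apply, LinearMap.sub_apply, LinearMap.smul_apply,
    slotDeriv_zero_pureTensor]
  simp only [pureTensor_two, map_sum, map_sub, map_smul, Finset.sum_mul, sub_mul, smul_mul_assoc]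

/-- Left Moyal multiplication by `y_x`. -/
noncomputable def leftCoord {n : ℕ} (ε : ℤˣ) (x : Fin (2 * n))
    (f : MvPolynomial (Fin (2 * n)) ℂ) : MvPolynomial (Fin (2 * n)) ℂ :=
  MvPolynomial.X x * f + (((ε : ℤ) : ℂ) / 2) • ham x f

theorem moyal_leftCoord {n : ℕ} (ε : ℤˣ) (x : Fin (2 * n))
    (a b : MvPolynomial (Fin (2 * n)) ℂ) :
    moyal n ε (leftCoord ε x a) b = leftCoord ε x (moyal n ε a b) := by
  have hX : pureTensor 2 n ![MvPolynomial.X x * a, b]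
      = LinearMap.mulLeft ℂ (MvPolynomial.X ((0 : Fin 2), x)) (pureTensor 2 n ![a, b]) := by
    simp [pureTensor_two, mul_assoc]
  have hc := (alphaOp_comm_hamSlot (n := n) (0 : Fin 2) 1 1 x).smul_left (((ε : ℤ) : ℂ) / 2)
  have hc0 := (alphaOp_comm_hamSlot (n := n) (0 : Fin 2) 1 0 x).smul_left (((ε : ℤ) : ℂ) / 2)
  have key := expOp_derivation (lowersDegree_moyal n ε)
    (T := LinearMap.mulLeft ℂ (MvPolynomial.X ((0 : Fin 2), x)))
    (δ := (((ε : ℤ) : ℂ) / 2) • hamSlot x 1)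
    (by rw [smul_mul_assoc, alphaOp_mulLeft_X (by decide), smul_add, mul_smul_comm])
    (hc.smul_right _) (pureTensor 2 n ![a, b])
  rw [leftCoord, moyal_add_left, moyal_smul_left, leftCoord]
  have h1 : moyal n ε (MvPolynomial.X x * a) b = MvPolynomial.X x * moyal n ε a b
      + (((ε : ℤ) : ℂ) / 2) • diagMul n (hamSlot x 1
        (expOp _ (lowersDegree_moyal n ε) (pureTensor 2 n ![a, b]))) := by
    rw [moyal, hX, key, map_add, LinearMap.mulLeft_apply, map_mul, LinearMap.smul_apply, map_smul]
    congr 2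
    simp [diagMul]
  have h2 : moyal n ε (ham x a) b = diagMul n (hamSlot x 0
        (expOp _ (lowersDegree_moyal n ε) (pureTensor 2 n ![a, b]))) := by
    rw [moyal, ← hamSlot_zero_pureTensor, expOp_comm _ hc0]
  rw [h1, h2, add_assoc, ← smul_add, add_comm (diagMul n _) (diagMul n _), ← ham_diagMul]
  rfl

theorem moyal_assoc {n : ℕ} (ε : ℤˣ) (a b c : MvPolynomial (Fin (2 * n)) ℂ) :
    moyal n ε (moyal n ε a b) c = moyal n ε a (moyal n ε b c) := by
  have mono : ∀ (d : ℕ) (s : Fin (2 * n) →₀ ℕ), s.degree = d → ∀ t : ℂ,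
      moyal n ε (moyal n ε (MvPolynomial.monomial s t) b) c
        = moyal n ε (MvPolynomial.monomial s t) (moyal n ε b c) := by
    intro d
    induction d using Nat.strong_induction_on with
    | _ d ih =>
      intro s hs t
      by_cases h0 : s = 0
      · subst h0
        have : (MvPolynomial.monomial 0 t : MvPolynomial (Fin (2 * n)) ℂ) = t • 1 := by
          rw [MvPolynomial.smul_eq_C_mul, mul_one]; rfl
        rw [this, moyal_smul_left, moyal_smul_left, moyal_smul_left, moyal_one_left,
          moyal_one_left]
      · obtain ⟨x, hx⟩ : ∃ x, s x ≠ 0 := by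
          by_contra hcon
          exact h0 (Finsupp.ext fun x => by by_contra hx; exact hcon ⟨x, hx⟩)
        obtain ⟨s₁, rfl⟩ : ∃ s₁, s = s₁ + Finsupp.single x 1 :=
          ⟨s - Finsupp.single x 1, (tsub_add_cancel_of_le (by
            rw [Finsupp.single_le_iff]; omega)).symm⟩
        have hdeg : s₁.degree + 1 = d := by simpa [map_add] using hs
        have low : ∀ y : Fin (2 * n), ∀ g h : MvPolynomial (Fin (2 * n)) ℂ,
            moyal n ε (moyal n ε (MvPolynomial.pderiv y (MvPolynomial.monomial s₁ t)) b) c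
              = moyal n ε (MvPolynomial.pderiv y (MvPolynomial.monomial s₁ t))
                (moyal n ε b c) := by
          intro y _ _
          rw [MvPolynomial.pderiv_monomial]
          refine ih _ ?_ _ rfl _
          have : (s₁ - Finsupp.single y 1).degree ≤ s₁.degree :=
            Finsupp.degree_mono tsub_le_self
          omega
        have hham : moyal n ε (moyal n ε (ham x (MvPolynomial.monomial s₁ t)) b) c
            = moyal n ε (ham x (MvPolynomial.monomial s₁ t)) (moyal n ε b c) := by
          have hs1 : ∀ (F : Fin n → MvPolynomial (Fin (2 * n)) ℂ) (g), moyal n ε (∑ j, F j) g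
              = ∑ j, moyal n ε (F j) g := fun F g =>
            map_sum (⟨⟨fun f => moyal n ε f g, by
              have := moyal_smul_left ε 0 (0 : MvPolynomial (Fin (2 * n)) ℂ) g
              simpa using this⟩, fun f h => moyal_add_left ε f h g⟩ :
                MvPolynomial (Fin (2 * n)) ℂ →+ MvPolynomial (Fin (2 * n)) ℂ) F _
          simp only [ham, hs1, sub_eq_add_neg, ← neg_one_smul ℂ (_ • _), moyal_add_left,
            moyal_smul_left]
          refine Finset.sum_congr rfl fun j _ => ?_
          rw [low _ 0 0, low _ 0 0]
        have hstep : MvPolynomial.monomial (s₁ + Finsupp.single x 1) t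
            = leftCoord ε x (MvPolynomial.monomial s₁ t)
              + (-(((ε : ℤ) : ℂ) / 2)) • ham x (MvPolynomial.monomial s₁ t) := by
          rw [leftCoord, MvPolynomial.X, MvPolynomial.monomial_mul, one_mul,
            add_comm (Finsupp.single x 1) s₁]
          module
        rw [hstep, moyal_add_left, moyal_add_left, moyal_add_left, moyal_leftCoord,
          moyal_leftCoord, moyal_leftCoord, moyal_smul_left, moyal_smul_left, moyal_smul_left,
          hham, ih _ (by omega) s₁ rfl]
  induction a using MvPolynomial.induction_on' with
  | monomial s t => exact mono _ s rfl t
  | add f g hf hg => simp only [moyal_add_left, hf, hg]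

/-- The Weyl algebra `𝒜_{2n}`: polynomials in `y_1, …, y_{2n}` with the Moyal product of sign
convention `ε`. For `ε = 1` one has `p_j ⋆ q_j - q_j ⋆ p_j = 1`. -/
def Weyl (n : ℕ) (_ε : ℤˣ) : Type := MvPolynomial (Fin (2 * n)) ℂ

noncomputable instance (n : ℕ) (ε : ℤˣ) : AddCommGroup (Weyl n ε) :=
  inferInstanceAs (AddCommGroup (MvPolynomial (Fin (2 * n)) ℂ))

noncomputable instance (n : ℕ) (ε : ℤˣ) : Module ℂ (Weyl n ε) :=
  inferInstanceAs (Module ℂ (MvPolynomial (Fin (2 * n)) ℂ))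

/-- The underlying polynomial. -/
noncomputable def Weyl.poly {n : ℕ} {ε : ℤˣ} :
    Weyl n ε ≃ₗ[ℂ] MvPolynomial (Fin (2 * n)) ℂ :=
  LinearEquiv.refl ℂ (MvPolynomial (Fin (2 * n)) ℂ)

noncomputable instance (n : ℕ) (ε : ℤˣ) : Ring (Weyl n ε) :=
  { (inferInstance : AddCommGroup (Weyl n ε)) with
    mul := fun a b => Weyl.poly.symm (moyal n ε a.poly b.poly)
    one := Weyl.poly.symm 1
    left_distrib := fun a b c => moyal_add_right ε a b c
    right_distrib := fun a b c => moyal_add_left ε a b c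
    zero_mul := fun a => by
      have := moyal_smul_left ε 0 (0 : MvPolynomial (Fin (2 * n)) ℂ) a
      simp only [zero_smul] at this
      exact this
    mul_zero := fun a => by
      have := moyal_smul_right ε 0 a (0 : MvPolynomial (Fin (2 * n)) ℂ)
      simp only [zero_smul] at this
      exact this
    mul_assoc := fun a b c => moyal_assoc ε a b c
    one_mul := fun a => moyal_one_left ε a
    mul_one := fun a => moyal_one_right ε a }

noncomputable instance (n : ℕ) (ε : ℤˣ) : Algebra ℂ (Weyl n ε) :=
  Algebra.ofModule (fun t a b => moyal_smul_left ε t a b) (fun t a b => moyal_smul_right ε t a b)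

/-- The coordinate `p_{j+1}` as an element of the Weyl algebra. -/
noncomputable def Weyl.p {n : ℕ} {ε : ℤˣ} (j : Fin n) : Weyl n ε :=
  Weyl.poly.symm (MvPolynomial.X (pIdx j))

/-- The coordinate `q_{j+1}` as an element of the Weyl algebra. -/
noncomputable def Weyl.q {n : ℕ} {ε : ℤˣ} (j : Fin n) : Weyl n ε :=
  Weyl.poly.symm (MvPolynomial.X (qIdx j))

/-! ## The cochain of Feigin, Felder and Shoikhet -/

/-- The ordered simplex `{0 = u_0 < u_1 < ⋯ < u_N < 1}`, in the coordinates `u_1, …, u_N`. -/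
def ordSimplex (N : ℕ) : Set (Fin N → ℝ) :=
  {u | StrictMono (Fin.cons 0 u : Fin (N + 1) → ℝ) ∧ ∀ i, u i < 1}

/-- `∑_{i < j} B_1(u_j - u_i) α_{s_j s_i}`, where `B_1(x) = x - 1/2` and the point `u_i` belongs to
the tensor factor `s_i`. -/
noncomputable def pairSum {m n N : ℕ} (s : Fin N → Fin m) (u : Fin N → ℝ) :
    Module.End ℂ (TensorPoly m n) :=
  ∑ i : Fin N, ∑ j ∈ Finset.Ioi i, ((u j - u i - 1 / 2 : ℝ) : ℂ) • alphaOp (s j) (s i)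

theorem lowersDegree_pairSum {m n N : ℕ} (s : Fin N → Fin m) (u : Fin N → ℝ) :
    LowersDegree (pairSum (n := n) s u) :=
  LowersDegree.sum _ fun _ => LowersDegree.sum _ fun _ => (lowersDegree_alphaOp _ _).smul _

/-- `μ (∏_{i < j} e^{B_1(u_j - u_i) α_{s_j s_i}} f)`, where `μ` evaluates all variables at `0`. The
operators `α_{rs}` commute, so the product of their exponentials is the exponential of the sum. -/
noncomputable def pairIntegrand {m n N : ℕ} (s : Fin N → Fin m) (f : TensorPoly m n)
    (u : Fin N → ℝ) : ℂ :=
  MvPolynomial.constantCoeff (expOp (pairSum s u) (lowersDegree_pairSum s u) f)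

theorem continuous_pairIntegrand {m n N : ℕ} (s : Fin N → Fin m) (f : TensorPoly m n) :
    Continuous (pairIntegrand s f) := by
  have hs : ∀ (r : Fin m) (x : Fin (2 * n)) (F : (Fin N → ℝ) → TensorPoly m n),
      (∀ t, Continuous fun u => MvPolynomial.coeff t (F u)) →
      ∀ t, Continuous fun u => MvPolynomial.coeff t (slotDeriv r x (F u)) := by
    intro r x F hF t
    simp only [slotDeriv, Derivation.coeFn_coe, MvPolynomial.coeff_pderiv]
    exact (hF _).mul continuous_const
  have hα : ∀ (r q : Fin m) (F : (Fin N → ℝ) → TensorPoly m n),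
      (∀ t, Continuous fun u => MvPolynomial.coeff t (F u)) →
      ∀ t, Continuous fun u => MvPolynomial.coeff t (alphaOp r q (F u)) := by
    intro r q F hF t
    simp only [alphaOp, LinearMap.sum_apply, LinearMap.sub_apply, Module.End.mul_apply,
      MvPolynomial.coeff_sum, MvPolynomial.coeff_sub]
    refine continuous_finsetSum _ fun j _ => ?_
    exact (hs _ _ _ (hs _ _ _ hF) t).sub (hs _ _ _ (hs _ _ _ hF) t)
  have hE : ∀ (F : (Fin N → ℝ) → TensorPoly m n),
      (∀ t, Continuous fun u => MvPolynomial.coeff t (F u)) →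
      ∀ t, Continuous fun u => MvPolynomial.coeff t (pairSum s u (F u)) := by
    intro F hF t
    simp only [pairSum, LinearMap.sum_apply, LinearMap.smul_apply, MvPolynomial.coeff_sum,
      MvPolynomial.coeff_smul, smul_eq_mul]
    refine continuous_finsetSum _ fun i _ => continuous_finsetSum _ fun j _ => ?_
    exact (Complex.continuous_ofReal.comp (by fun_prop)).mul (hα _ _ _ hF t)
  have hP : ∀ k : ℕ, ∀ t, Continuous fun u => MvPolynomial.coeff t ((pairSum s u ^ k) f) := by
    intro k
    induction k with
    | zero => intro t; simpa using continuous_const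
    | succ k ih =>
      intro t
      simp only [pow_succ', Module.End.mul_apply]
      exact hE _ ih t
  obtain ⟨d, hd⟩ := exists_degLT f
  have : pairIntegrand s f = fun u => ∑ k ∈ Finset.range d,
      ((Nat.factorial k : ℂ)⁻¹) * MvPolynomial.coeff 0 ((pairSum s u ^ k) f) := by
    funext u
    rw [pairIntegrand, expOp_eq_sum _ hd, MvPolynomial.constantCoeff_eq, MvPolynomial.coeff_sum]
    simp
  rw [this]
  exact continuous_finsetSum _ fun k _ => continuous_const.mul (hP k 0)

theorem integrableOn_pairIntegrand {m n N : ℕ} (s : Fin (N + 1) → Fin m) (f : TensorPoly m n) :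
    MeasureTheory.IntegrableOn (fun u : Fin N → ℝ => pairIntegrand s f (Fin.cons 0 u))
      (ordSimplex N) := by
  have hc : Continuous fun u : Fin N → ℝ => pairIntegrand s f (Fin.cons 0 u) := by
    refine (continuous_pairIntegrand s f).comp (continuous_pi fun i => ?_)
    refine Fin.cases ?_ (fun i => ?_) i
    · simpa using continuous_const
    · simpa using continuous_apply i
  refine (hc.continuousOn.integrableOn_compact
    (isCompact_Icc (a := (0 : Fin N → ℝ)) (b := 1))).mono_set fun u hu => ⟨fun i => ?_, fun i => (hu.2 i).le⟩
  have := hu.1 (Fin.succ_pos i)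
  simpa using this.le

/-- `f ↦ μ ∫_{0 = u_0 < u_1 < ⋯ < u_N < 1} du_1 ⋯ du_N ∏_{i < j} e^{B_1(u_j - u_i) α_{s_j s_i}} f`. -/
noncomputable def pairIntegral {m n N : ℕ} (s : Fin (N + 1) → Fin m) :
    TensorPoly m n →ₗ[ℂ] ℂ where
  toFun f := ∫ u in ordSimplex N, pairIntegrand s f (Fin.cons 0 u)
  map_add' f g := by
    rw [← MeasureTheory.integral_add (integrableOn_pairIntegrand s f)
      (integrableOn_pairIntegrand s g)]
    simp [pairIntegrand]
  map_smul' c f := by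
    rw [RingHom.id_apply, smul_eq_mul, ← MeasureTheory.integral_const_mul]
    simp [pairIntegrand]

/-- The determinant `π_{2n} = det (_i∂_x)_{1 ≤ i ≤ 2n, 1 ≤ x ≤ 2n}` of commuting operators, which
acts on the factors `1, …, 2n` of `a_0 ⊗ a_1 ⊗ ⋯ ⊗ a_{2n}`. -/
noncomputable def detDeriv (n : ℕ) : Module.End ℂ (TensorPoly (2 * n + 1) n) :=
  ∑ σ : Equiv.Perm (Fin (2 * n)), ((Equiv.Perm.sign σ : ℤ) : ℂ) •
    (List.ofFn fun i : Fin (2 * n) => slotDeriv i.succ (σ i)).prod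

theorem slotDeriv_pureTensor_of_one {m n : ℕ} (a : Fin m → MvPolynomial (Fin (2 * n)) ℂ)
    (r : Fin m) (ha : a r = 1) (x : Fin (2 * n)) : slotDeriv r x (pureTensor m n a) = 0 := by
  simp only [pureTensor, MultilinearMap.compLinearMap_apply, MultilinearMap.mkPiAlgebra_apply]
  refine Finset.prod_induction _ (fun f => slotDeriv r x f = 0) ?_ ?_ ?_
  · intro f g hf hg
    rw [slotDeriv_mul, hf, hg, zero_mul, mul_zero, add_zero]
  · simp [slotDeriv]
  · intro i _
    by_cases h : r = i
    · subst h; simp [ha, slotDeriv]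
    · exact slotDeriv_rename_of_ne h x (a i)

theorem list_prod_apply_eq_zero {V : Type*} [AddCommGroup V] [Module ℂ V]
    (l : List (Module.End ℂ V)) (hl : ∀ D ∈ l, ∀ E ∈ l, Commute D E) (v : V)
    (hv : ∃ D ∈ l, D v = 0) : l.prod v = 0 := by
  induction l with
  | nil => simp at hv
  | cons D l ih =>
    obtain ⟨E, hE, hEv⟩ := hv
    rw [List.prod_cons]
    rcases List.mem_cons.1 hE with h | h
    · subst h
      have hc : Commute E l.prod := Commute.list_prod_right l E fun F hF =>
        hl E List.mem_cons_self F (List.mem_cons_of_mem _ hF)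
      rw [hc.eq, Module.End.mul_apply, hEv, map_zero]
    · rw [Module.End.mul_apply, ih (fun F hF G hG => hl F (List.mem_cons_of_mem _ hF) G
        (List.mem_cons_of_mem _ hG)) ⟨E, h, hEv⟩, map_zero]

theorem detDeriv_pureTensor_of_one {n : ℕ} (a : Fin (2 * n + 1) → MvPolynomial (Fin (2 * n)) ℂ)
    (r : Fin (2 * n + 1)) (hr : r ≠ 0) (ha : a r = 1) :
    detDeriv n (pureTensor (2 * n + 1) n a) = 0 := by
  simp only [detDeriv, LinearMap.sum_apply, LinearMap.smul_apply]
  refine Finset.sum_eq_zero fun σ _ => ?_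
  obtain ⟨i, rfl⟩ := Fin.exists_succ_eq.2 hr
  rw [list_prod_apply_eq_zero, smul_zero]
  · intro D hD E hE
    obtain ⟨k, rfl⟩ := (List.mem_ofFn' _ _).1 hD
    obtain ⟨l, rfl⟩ := (List.mem_ofFn' _ _).1 hE
    exact slotDeriv_comm _ _ _ _
  · exact ⟨slotDeriv i.succ (σ i), (List.mem_ofFn' _ _).2 ⟨i, rfl⟩,
      slotDeriv_pureTensor_of_one a _ ha _⟩

/-- The cochain `τ_{2n} = μ_{2n} ∘ S_{2n} ∘ π_{2n}`, with
`S_{2n} = ∫_{0 = u_0 < u_1 < ⋯ < u_{2n} < 1} du_1 ⋯ du_{2n} ∏_{0 ≤ i < j ≤ 2n} e^{B_1(u_j - u_i) α_{ji}}`. -/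
noncomputable def tauFFS (n : ℕ) (ε : ℤˣ) : NormCochain (Weyl n ε) (2 * n) :=
  ⟨((pairIntegral (fun i : Fin (2 * n + 1) => i) ∘ₗ detDeriv n).compMultilinearMap
      (pureTensor (2 * n + 1) n)).compLinearMap (fun _ => Weyl.poly.toLinearMap), by
    intro a r hr ha
    have h1 : Weyl.poly (a r) = 1 := by rw [ha]; rfl
    have h2 := detDeriv_pureTensor_of_one (fun i => Weyl.poly (a i)) r hr h1
    simp [h2]⟩

/-- `μ_{2n} ∫_{0 = u_1 < u_2 < ⋯ < u_{2n} < 1} du_2 ⋯ du_{2n} ∏_{1 ≤ i < j ≤ 2n}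
e^{B_1(u_j - u_i) α_{ji}} π_{2n} (1 ⊗ a_1 ⊗ ⋯ ⊗ a_{2n})` for `2n = 2(k + 1)`: the point `u_i` belongs
to the tensor factor `i`, and no point belongs to the factor `0`. -/
noncomputable def circlePointsIntegral (k : ℕ) (ε : ℤˣ) (a : Fin (2 * k + 2) → Weyl (k + 1) ε) : ℂ :=
  pairIntegral (N := 2 * k + 1) (fun i : Fin (2 * k + 2) => i.succ)
    (detDeriv (k + 1) (pureTensor (2 * (k + 1) + 1) (k + 1)
      (Fin.cons 1 (fun i : Fin (2 * k + 2) => Weyl.poly (a i)))))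

/-- `ι_ω = ∑_j ι_{p_j} ι_{q_j}`. -/
noncomputable def iotaOmega (n : ℕ) (ε : ℤˣ) (k : ℕ) :
    NormCochain (Weyl n ε) (k + 2) →ₗ[ℂ] NormCochain (Weyl n ε) k :=
  ∑ j : Fin n, hochInterior k (Weyl.p j) ∘ₗ hochInterior (k + 1) (Weyl.q j)

/-- `L_ω = [d, ι_ω] = d ι_ω - ι_ω d` (the commutator, as `ι_ω` has even degree), on cochains of
degree at least two. -/
noncomputable def LOmega (n : ℕ) (ε : ℤˣ) (k : ℕ) :
    NormCochain (Weyl n ε) (k + 2) →ₗ[ℂ] NormCochain (Weyl n ε) (k + 1) :=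
  hochschildD k ∘ₗ iotaOmega n ε k - iotaOmega n ε (k + 1) ∘ₗ hochschildD (k + 2)

/-! ## Integration over the ordered simplex -/

/-! The integrand is a function of points on a circle of length one. Since B_1(1 - x) = -B_1(x) and
α_{sr} = -α_{rs}, moving the base point to the next point changes only the labels
(`pairSum_finRotate`). A tensor factor in which no variable is left pairs with nothing, so its point
is free, and the lengths of the gaps in which it can move add up to 1 (`sum_gaps`,
`sum_rebase_gaps`). Each formula combines these two facts with an identity for determinants.

For B, the unit in slot 0 makes the point u_0 free. Seen from the first of the other 2n points, it
lies in the gap that closes the circle, and integrating over it gives the length of this gap as a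
weight (`setIntegral_pairIntegrand`). The cyclic permutations of the arguments carry this gap to all
the others. The sign (-1)^{(2n-1)j} of the j-th summand cancels against the sign of the rotation of
the rows of the determinant (`relabel_finRotate_det`), and the weights add up to 1
(`sum_setIntegral_rotate`).

For L_ω, write L_b for the action of the derivation a ↦ ab - ba, so that d ι_b + ι_b d = L_b by
Cartan's formula (`hochschildForm_interiorForm`). Then [d, ι_p ι_q] = L_p ι_q - ι_p L_q, and ι_p
commutes with L_q on normalized cochains because [p, q] is a scalar. Commutators with coordinates
are derivatives up to sign, so L_ω = -ε ∑_x ∂_x ι_{y_x} with ∂_x acting on all arguments by the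
Leibniz rule (`LOmega_apply`). This holds on every normalized cochain of degree at least two;
closedness of τ plays no role.

When y_x is inserted into τ, the determinant has to differentiate it, which leaves a constant with a
free point. What remains is (-1)^x times the minor without column x, with x counted from 0
(`sum_pairIntegral_coord_mul_relabel`). Finally ∑_x (-1)^x ∂_x times this minor is the Laplace
expansion of a determinant whose top row is the sum of the rows of all factors. Row operations turn
it into the determinant in I (`sum_totalDeriv_mul_det`). -/

/-- `(0, v_1, …, v_N, 1)`. -/
def withEnds {N : ℕ} (v : Fin N → ℝ) : Fin (N + 2) → ℝ :=
  Fin.snoc (α := fun _ => ℝ) (Fin.cons (α := fun _ => ℝ) 0 v) 1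

@[simp] theorem withEnds_zero {N : ℕ} (v : Fin N → ℝ) : withEnds v 0 = 0 := by
  rw [← Fin.castSucc_zero, withEnds, Fin.snoc_castSucc, Fin.cons_zero]

@[simp] theorem withEnds_last {N : ℕ} (v : Fin N → ℝ) : withEnds v (Fin.last (N + 1)) = 1 := by
  rw [withEnds, Fin.snoc_last]

@[simp] theorem withEnds_succ_castSucc {N : ℕ} (v : Fin N → ℝ) (i : Fin N) :
    withEnds v i.succ.castSucc = v i := by
  rw [withEnds, Fin.snoc_castSucc, Fin.cons_succ]

@[simp] theorem withEnds_castSucc_succ {N : ℕ} (v : Fin N → ℝ) (i : Fin N) :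
    withEnds v i.castSucc.succ = v i := by
  rw [Fin.succ_castSucc, withEnds_succ_castSucc]

theorem continuous_withEnds {N : ℕ} (i : Fin (N + 2)) :
    Continuous fun v : Fin N → ℝ => withEnds v i := by
  refine Fin.lastCases ?_ (fun i => ?_) i
  · simpa using continuous_const
  · refine Fin.cases ?_ (fun i => ?_) i
    · simpa using continuous_const
    · simpa using continuous_apply i

theorem mem_ordSimplex_iff_bounds {N : ℕ} {u : Fin N → ℝ} :
    u ∈ ordSimplex N ↔ StrictMono u ∧ (∀ i, 0 < u i) ∧ ∀ i, u i < 1 := by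
  rw [ordSimplex, Set.mem_ofPred_eq, Fin.strictMono_cons]
  tauto

theorem mem_ordSimplex_iff {N : ℕ} {u : Fin N → ℝ} :
    u ∈ ordSimplex N ↔ StrictMono (withEnds u) := by
  rw [withEnds, ← Fin.insertNth_last', Fin.strictMono_insertNth_iff, ordSimplex,
    Set.mem_ofPred_eq]
  refine and_congr_right fun _ => ⟨fun h => ⟨fun i _ => ?_, fun i hi => ?_⟩, fun h i => ?_⟩
  · refine Fin.cases ?_ (fun i => ?_) i
    · simp
    · simpa using h i
  · exact absurd hi (not_le.2 (Fin.castSucc_lt_last i))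
  · simpa using h.1 i.succ (Fin.castSucc_lt_last _)

theorem withEnds_insertNth {N : ℕ} (s : Fin (N + 1)) (t : ℝ) (v : Fin N → ℝ) :
    withEnds (Fin.insertNth (α := fun _ => ℝ) s t v)
      = Fin.insertNth (α := fun _ => ℝ) s.castSucc.succ t (withEnds v) := by
  rw [Fin.eq_insertNth_iff]
  refine ⟨by simp, funext fun i => ?_⟩
  rw [Fin.removeNth]
  refine Fin.lastCases ?_ (fun i => ?_) i
  · rw [Fin.succAbove_of_le_castSucc _ _ (by simp [Fin.le_def]; omega), Fin.succ_last]
    simp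
  · refine Fin.cases ?_ (fun i => ?_) i
    · simp
    · rw [Fin.succ_castSucc, Fin.castSucc_succAbove_castSucc, Fin.succ_succAbove_succ]
      simp

theorem insertNth_mem_ordSimplex {N : ℕ} (s : Fin (N + 1)) (t : ℝ) (v : Fin N → ℝ) :
    Fin.insertNth (α := fun _ => ℝ) s t v ∈ ordSimplex (N + 1) ↔
      v ∈ ordSimplex N ∧ t ∈ Set.Ioo (withEnds v s.castSucc) (withEnds v s.succ) := by
  rw [mem_ordSimplex_iff, mem_ordSimplex_iff, withEnds_insertNth]
  refine ⟨fun h => ?_, fun h => Fin.strictMono_insertNth h.1 s t h.2.1 h.2.2⟩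
  obtain ⟨h1, h2, h3⟩ := (Fin.strictMono_insertNth_iff _ _ _).1 h
  exact ⟨h1, h2 _ (by simp), h3 _ (by simp)⟩

theorem measurableSet_ordSimplex (N : ℕ) : MeasurableSet (ordSimplex N) := by
  have : ordSimplex N = ⋂ (i : Fin (N + 2)) (j : Fin (N + 2)) (_ : i < j),
      {u : Fin N → ℝ | withEnds u i < withEnds u j} := by
    ext u
    simp only [mem_ordSimplex_iff, Set.mem_iInter, Set.mem_ofPred_eq]
    rfl
  rw [this]
  refine MeasurableSet.iInter fun i => MeasurableSet.iInter fun j => MeasurableSet.iInter fun _ => ?_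
  exact measurableSet_lt (continuous_withEnds i).measurable (continuous_withEnds j).measurable

theorem Continuous.integrableOn_ordSimplex {N : ℕ} {F : (Fin N → ℝ) → ℂ} (hF : Continuous F) :
    MeasureTheory.IntegrableOn F (ordSimplex N) := by
  refine (hF.continuousOn.integrableOn_compact
    (isCompact_Icc (a := (0 : Fin N → ℝ)) (b := 1))).mono_set fun u hu => ?_
  rw [mem_ordSimplex_iff_bounds] at hu
  exact ⟨fun i => (hu.2.1 i).le, fun i => (hu.2.2 i).le⟩

theorem sum_gaps {N : ℕ} (v : Fin N → ℝ) :
    ∑ s : Fin (N + 1), (withEnds v s.succ - withEnds v s.castSucc) = 1 := by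
  have h1 := Fin.sum_univ_succ (withEnds v)
  have h2 := Fin.sum_univ_castSucc (withEnds v)
  rw [Finset.sum_sub_distrib]
  simp only [withEnds_zero, withEnds_last] at h1 h2
  linarith

/-! ### Integrating out one free point. -/

open MeasureTheory in
/-- Integrating out the coordinate `u_s` produces the length of the gap that it moves in. -/
theorem setIntegral_removeNth {N : ℕ} (s : Fin (N + 1)) {F : (Fin N → ℝ) → ℂ}
    (hF : Continuous F) :
    ∫ u in ordSimplex (N + 1), F (s.removeNth u)
      = ∫ v in ordSimplex N, ((withEnds v s.succ - withEnds v s.castSucc : ℝ) : ℂ) * F v := by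
  set e := MeasurableEquiv.piFinSuccAbove (fun _ : Fin (N + 1) => ℝ) s
  have he : MeasurePreserving e := volume_preserving_piFinSuccAbove (fun _ => ℝ) s
  have hc : Continuous fun u : Fin (N + 1) → ℝ => F (s.removeNth u) :=
    hF.comp (continuous_pi fun i => continuous_apply _)
  have hint := (hc.integrableOn_ordSimplex).integrable_indicator (measurableSet_ordSimplex (N + 1))
  rw [← integral_indicator (measurableSet_ordSimplex _),
    ← integral_indicator (measurableSet_ordSimplex _), ← he.symm.integral_comp',
    Measure.volume_eq_prod, integral_prod_symm]
  · refine integral_congr_ae (Filter.Eventually.of_forall fun v => ?_)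
    -- Fubini with the coordinate u_s split off: over a fixed v the fibre of the simplex is the open
    -- gap number s.
    have hpt : ∀ t, (ordSimplex (N + 1)).indicator (fun u => F (s.removeNth u)) (e.symm (t, v))
        = (ordSimplex N).indicator (fun _ => (Set.Ioo (withEnds v s.castSucc)
          (withEnds v s.succ)).indicator (fun _ => F v) t) v := by
      intro t
      have h1 : e.symm (t, v) = Fin.insertNth (α := fun _ => ℝ) s t v := rfl
      rw [h1]
      by_cases hv : v ∈ ordSimplex N <;>
        by_cases ht : t ∈ Set.Ioo (withEnds v s.castSucc) (withEnds v s.succ) <;>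
        simp only [Set.indicator, insertNth_mem_ordSimplex, hv, ht, and_true, and_false, if_true,
          if_false, Fin.removeNth_insertNth]
    simp only [hpt]
    by_cases hv : v ∈ ordSimplex N
    · have hlt : withEnds v s.castSucc < withEnds v s.succ :=
        mem_ordSimplex_iff.1 hv Fin.castSucc_lt_succ
      simp only [Set.indicator_of_mem hv]
      rw [integral_indicator measurableSet_Ioo, setIntegral_const]
      simp [hlt.le]
    · simp [Set.indicator_of_notMem hv]
  · exact (he.symm.integrable_comp_emb e.symm.measurableEmbedding).2 hint

/-- A free point on the circle integrates to `1`. -/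
theorem sum_setIntegral_removeNth {N : ℕ} {F : (Fin N → ℝ) → ℂ} (hF : Continuous F) :
    ∑ s : Fin (N + 1), ∫ u in ordSimplex (N + 1), F (s.removeNth u)
      = ∫ v in ordSimplex N, F v := by
  simp only [setIntegral_removeNth _ hF]
  rw [← MeasureTheory.integral_finsetSum]
  · refine MeasureTheory.integral_congr_ae (Filter.Eventually.of_forall fun v => ?_)
    simp only
    rw [← Finset.sum_mul, ← Complex.ofReal_sum, sum_gaps, Complex.ofReal_one, one_mul]
  · intro s _
    refine Continuous.integrableOn_ordSimplex (Continuous.mul ?_ hF)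
    exact Complex.continuous_ofReal.comp ((continuous_withEnds _).sub (continuous_withEnds _))

/-! ### Change of the base point on the circle. -/

/-- The rotation of the circle that moves `v_1` to the base point. -/
def rebase {N : ℕ} (v : Fin (N + 1) → ℝ) : Fin (N + 1) → ℝ :=
  Fin.snoc (α := fun _ => ℝ) (fun i : Fin N => v i.succ - v 0) (1 - v 0)

theorem continuous_rebase (N : ℕ) : Continuous (rebase (N := N)) := by
  refine continuous_pi fun i => ?_
  refine Fin.lastCases ?_ (fun i => ?_) i
  · simp only [rebase, Fin.snoc_last]; fun_prop
  · simp only [rebase, Fin.snoc_castSucc]; fun_prop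

/-- The gaps of `rebase v` are those of `v`, cyclically permuted, and the simplex is the locus where
all gaps are positive. -/
theorem rebase_mem_ordSimplex {N : ℕ} (v : Fin (N + 1) → ℝ) :
    rebase v ∈ ordSimplex (N + 1) ↔ v ∈ ordSimplex (N + 1) := by
  have h1 := Fin.strictMono_insertNth_iff (Fin.last N) (1 - v 0) (fun i : Fin N => v i.succ - v 0)
  have h2 := Fin.strictMono_cons (f := fun i : Fin N => v i.succ) (a := v 0)
  rw [show (Fin.cons (v 0) (fun i : Fin N => v i.succ) : Fin (N + 1) → ℝ) = v from
    Fin.cons_self_tail v] at h2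
  have h3 : StrictMono (fun i : Fin N => v i.succ - v 0) ↔ StrictMono fun i : Fin N => v i.succ := by
    simp only [StrictMono, sub_lt_sub_iff_right]
  rw [Fin.insertNth_last'] at h1
  rw [mem_ordSimplex_iff_bounds, mem_ordSimplex_iff_bounds, rebase, h1, h2, h3, Fin.forall_fin_succ',
    Fin.forall_fin_succ', Fin.forall_fin_succ (P := fun i => 0 < v i),
    Fin.forall_fin_succ (P := fun i => v i < 1)]
  simp only [Fin.snoc_castSucc, Fin.snoc_last, Fin.castSucc_lt_last, true_imp_iff, sub_pos,
    sub_lt_sub_iff_right]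
  have h4 : ∀ i : Fin N, ¬ Fin.last N ≤ i.castSucc := fun i => not_le.2 (Fin.castSucc_lt_last i)
  simp only [h4, false_imp_iff, implies_true, and_true]
  constructor
  · rintro ⟨⟨h5, h6⟩, ⟨h7, h8⟩, h9, h10⟩
    exact ⟨⟨h7, h5⟩, ⟨by linarith, fun i => by linarith [h7 i]⟩, h8, h6⟩
  · rintro ⟨⟨h5, h6⟩, ⟨h7, h8⟩, h9, h10⟩
    exact ⟨⟨h6, h10⟩, ⟨h5, h9⟩, fun i => by linarith [h10 i], by linarith⟩

-- After `v 0` is split off, the map is the shear (t, y) ↦ (1 - t, y - t): a reflection in t and,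
-- for each t, a translation in y. The new coordinate is put back in the last place.
open MeasureTheory in
theorem measurePreserving_rebase (N : ℕ) :
    MeasurePreserving (rebase (N := N)) volume volume := by
  have h1 := volume_preserving_piFinSuccAbove (fun _ : Fin (N + 1) => ℝ) 0
  have h2 := (volume_preserving_piFinSuccAbove (fun _ : Fin (N + 1) => ℝ) (Fin.last N)).symm
  have h3 : MeasurePreserving
      (fun p : ℝ × (Fin N → ℝ) => (1 - p.1, p.2 - Function.const (Fin N) p.1))
      (volume.prod volume) (volume.prod volume) := by
    refine MeasurePreserving.skew_product (g := fun t y => y - Function.const (Fin N) t)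
      (Measure.measurePreserving_sub_left volume 1) ?_ (Filter.Eventually.of_forall fun t => ?_)
    · exact (measurable_snd.sub (measurable_pi_lambda _ fun _ => measurable_fst))
    · exact (measurePreserving_sub_right volume (Function.const (Fin N) t)).map_eq
  have h4 := h2.comp (h3.comp h1)
  refine (congrArg (fun f => MeasurePreserving f volume volume) (funext fun v => ?_)).mp h4
  exact Fin.insertNth_last' (β := ℝ) _ _

theorem setIntegral_comp_rebase {N : ℕ} {F : (Fin (N + 1) → ℝ) → ℂ} (hF : Continuous F) :
    ∫ v in ordSimplex (N + 1), F (rebase v) = ∫ v in ordSimplex (N + 1), F v := by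
  conv_rhs => rw [← (measurePreserving_rebase N).map_eq]
  rw [MeasureTheory.setIntegral_map (measurableSet_ordSimplex _)
    hF.measurable.aestronglyMeasurable (measurePreserving_rebase N).measurable.aemeasurable]
  congr 2
  ext v
  exact (rebase_mem_ordSimplex v).symm

/-- After j rotations the base point sits at entry j of `withEnds v`. The bound `i + j ≤ N` selects
the points that have not yet been carried past the end of the interval. -/
theorem rebase_iterate_apply {N : ℕ} (v : Fin (N + 1) → ℝ) (j i : ℕ) (h : i + j ≤ N) :
    (rebase^[j] v) ⟨i, by omega⟩ = withEnds v ⟨i + j + 1, by omega⟩ - withEnds v ⟨j, by omega⟩ := by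
  induction j generalizing i with
  | zero =>
    have h0 : withEnds v ⟨0, by omega⟩ = 0 := withEnds_zero v
    rw [h0, sub_zero]
    exact (withEnds_succ_castSucc v ⟨i, by omega⟩).symm
  | succ j ih =>
    have h1 : (⟨i, by omega⟩ : Fin (N + 1)) = Fin.castSucc ⟨i, by omega⟩ := rfl
    have h2 : (0 : Fin (N + 1)) = ⟨0, by omega⟩ := rfl
    rw [Function.iterate_succ_apply', h1, rebase, Fin.snoc_castSucc, Fin.succ_mk, h2,
      ih (i + 1) (by omega), ih 0 (by omega)]
    simp only [Nat.zero_add, Nat.add_right_comm i 1 j, add_assoc]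
    ring

/-- For j = 0 the summand is the last gap of `v`. After j + 1 rotations it is the gap that the base
point has just crossed, which is gap number j. Each of the N + 2 gaps occurs once. -/
theorem sum_rebase_gaps {N : ℕ} (v : Fin (N + 1) → ℝ) :
    ∑ j : Fin (N + 2), (1 - (rebase^[(j : ℕ)] v) (Fin.last N)) = 1 := by
  refine Eq.trans ?_ (sum_gaps v)
  rw [Fin.sum_univ_succ, Fin.sum_univ_castSucc (n := N + 1), add_comm]
  congr 1
  · refine Finset.sum_congr rfl fun j _ => ?_
    have h2 : (0 : Fin (N + 1)) = ⟨0, by omega⟩ := rfl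
    rw [Fin.val_succ, Function.iterate_succ_apply']
    generalize hw : rebase^[(j : ℕ)] v = w
    have h3 : rebase w (Fin.last N) = 1 - w 0 := by simp [rebase]
    rw [h3, ← hw, h2, rebase_iterate_apply v j 0 (by omega)]
    simp only [Nat.zero_add, sub_sub_cancel]
    rfl
  · rw [Fin.succ_last, withEnds_last, ← Fin.succ_last, withEnds_succ_castSucc]
    rfl

/-! ## Constant coefficient differential operators on tensor powers -/

/-- The algebra of constant coefficient differential operators. -/
noncomputable def diffAlgebra (m n : ℕ) : Subalgebra ℂ (Module.End ℂ (TensorPoly m n)) :=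
  Algebra.adjoin ℂ (Set.range fun i : Fin m × Fin (2 * n) => slotDeriv i.1 i.2)

/-- `MvPolynomial.aeval` needs a commutative target, which `Module.End` is not; commutativity of the
generators suffices. Through `diffOp`, identities between determinants of derivatives can then be
proved in a polynomial ring. -/
instance (m n : ℕ) : IsMulCommutative (diffAlgebra m n) :=
  Algebra.isMulCommutative_adjoin ℂ (by
    rintro _ ⟨i, rfl⟩ _ ⟨j, rfl⟩
    exact slotDeriv_comm _ _ _ _)

open scoped IsMulCommutative in
/-- The action of polynomials as constant coefficient differential operators: the variable `(r, x)`
acts by the derivative with respect to the coordinate `x` on the factor `r`. -/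
noncomputable def diffOp (m n : ℕ) : TensorPoly m n →ₐ[ℂ] Module.End ℂ (TensorPoly m n) :=
  (diffAlgebra m n).val.comp (MvPolynomial.aeval fun i : Fin m × Fin (2 * n) =>
    (⟨slotDeriv i.1 i.2, Algebra.subset_adjoin ⟨i, rfl⟩⟩ : diffAlgebra m n))

@[simp] theorem diffOp_X {m n : ℕ} (i : Fin m × Fin (2 * n)) :
    diffOp m n (MvPolynomial.X i) = slotDeriv i.1 i.2 := by
  simp [diffOp]

/-- Relabelling of the tensor factors. -/
noncomputable def relabel {m m' : ℕ} (n : ℕ) (σ : Fin m → Fin m') :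
    TensorPoly m n →ₐ[ℂ] TensorPoly m' n :=
  MvPolynomial.rename (Prod.map σ id)

@[simp] theorem relabel_X {m m' n : ℕ} (σ : Fin m → Fin m') (r : Fin m) (x : Fin (2 * n)) :
    relabel n σ (MvPolynomial.X (r, x)) = MvPolynomial.X (σ r, x) := by
  simp [relabel]

theorem relabel_rename {m m' n : ℕ} (σ : Fin m → Fin m') (r : Fin m)
    (a : MvPolynomial (Fin (2 * n)) ℂ) :
    relabel n σ (MvPolynomial.rename (Prod.mk r) a) = MvPolynomial.rename (Prod.mk (σ r)) a := by
  rw [relabel, MvPolynomial.rename_rename]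
  rfl

theorem slotDeriv_relabel {m m' n : ℕ} {σ : Fin m → Fin m'} (hσ : Function.Injective σ)
    (r : Fin m) (x : Fin (2 * n)) (f : TensorPoly m n) :
    slotDeriv (σ r) x (relabel n σ f) = relabel n σ (slotDeriv r x f) :=
  MvPolynomial.pderiv_rename (f := Prod.map σ (id : Fin (2 * n) → Fin (2 * n)))
    (hσ.prodMap Function.injective_id) (r, x) f

theorem slotDeriv_relabel_of_notMem {m m' n : ℕ} {σ : Fin m → Fin m'} {r : Fin m'}
    (hr : ∀ q, r ≠ σ q) (x : Fin (2 * n)) (f : TensorPoly m n) :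
    slotDeriv r x (relabel n σ f) = 0 := by
  induction f using MvPolynomial.induction_on with
  | C c => simp [slotDeriv, relabel]
  | add f g hf hg => rw [map_add, map_add, hf, hg, add_zero]
  | mul_X f i hf =>
    have : ((σ i.1, i.2) : Fin m' × Fin (2 * n)) ≠ (r, x) :=
      fun e => hr i.1 (congrArg Prod.fst e).symm
    rw [map_mul, slotDeriv_mul, hf, relabel_X]
    simp [slotDeriv, MvPolynomial.pderiv_X_of_ne this]

theorem diffOp_relabel {m m' n : ℕ} {σ : Fin m → Fin m'} (hσ : Function.Injective σ)
    (P f : TensorPoly m n) :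
    diffOp m' n (relabel n σ P) (relabel n σ f) = relabel n σ (diffOp m n P f) := by
  induction P using MvPolynomial.induction_on generalizing f with
  | C c =>
    have h (k : ℕ) (g : TensorPoly k n) : diffOp k n (MvPolynomial.C c) g = c • g := by
      rw [← MvPolynomial.algebraMap_eq, AlgHom.commutes, Module.algebraMap_end_apply]
    rw [relabel, MvPolynomial.rename_C, h, h, map_smul]
  | add P Q hP hQ => rw [map_add, map_add, map_add, LinearMap.add_apply, hP, hQ, LinearMap.add_apply,
      map_add]
  | mul_X P i hP =>
    rw [map_mul, map_mul, map_mul, Module.End.mul_apply, Module.End.mul_apply, relabel_X, diffOp_X,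
      diffOp_X, slotDeriv_relabel hσ, hP]

theorem expOp_intertwine {σ τ : Type*} {D : Module.End ℂ (MvPolynomial σ ℂ)}
    {E : Module.End ℂ (MvPolynomial τ ℂ)} (hD : LowersDegree D) (hE : LowersDegree E)
    (T : MvPolynomial σ ℂ →ₗ[ℂ] MvPolynomial τ ℂ) (h : ∀ f, E (T f) = T (D f))
    (f : MvPolynomial σ ℂ) : expOp E hE (T f) = T (expOp D hD f) := by
  obtain ⟨d, hd⟩ := exists_degLT f
  obtain ⟨e, he⟩ := exists_degLT (T f)
  rw [expOp_eq_sum hD (hd.mono (le_max_left d e)), expOp_eq_sum hE (he.mono (le_max_right d e)),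
    map_sum]
  refine Finset.sum_congr rfl fun k hk => ?_
  rw [map_smul]
  congr 1
  clear hk
  induction k with
  | zero => rfl
  | succ k ih => rw [pow_succ', pow_succ', Module.End.mul_apply, Module.End.mul_apply, ih, h]

theorem alphaOp_relabel {m m' n : ℕ} {σ : Fin m → Fin m'} (hσ : Function.Injective σ)
    (r s : Fin m) (f : TensorPoly m n) :
    alphaOp (σ r) (σ s) (relabel n σ f) = relabel n σ (alphaOp r s f) := by
  simp only [alphaOp, LinearMap.sum_apply, LinearMap.sub_apply, Module.End.mul_apply, map_sum,
    map_sub, slotDeriv_relabel hσ]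

theorem alphaOp_swap {m n : ℕ} (r s : Fin m) :
    alphaOp (n := n) r s = -alphaOp s r := by
  simp only [alphaOp, ← Finset.sum_neg_distrib]
  refine Finset.sum_congr rfl fun j _ => ?_
  rw [(slotDeriv_comm r s (pIdx j) (qIdx j)).eq, (slotDeriv_comm r s (qIdx j) (pIdx j)).eq]
  abel

theorem alphaOp_relabel_of_notMem {m m' n : ℕ} {σ : Fin m → Fin m'} {r : Fin m'}
    (hr : ∀ q, r ≠ σ q) (s : Fin m') (f : TensorPoly m n) :
    alphaOp s r (relabel n σ f) = 0 := by
  simp only [alphaOp, LinearMap.sum_apply, LinearMap.sub_apply, Module.End.mul_apply,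
    slotDeriv_relabel_of_notMem hr, map_zero, sub_zero, Finset.sum_const_zero]

theorem alphaOp_relabel_of_notMem' {m m' n : ℕ} {σ : Fin m → Fin m'} {r : Fin m'}
    (hr : ∀ q, r ≠ σ q) (s : Fin m') (f : TensorPoly m n) :
    alphaOp r s (relabel n σ f) = 0 := by
  rw [alphaOp_swap, LinearMap.neg_apply, alphaOp_relabel_of_notMem hr, neg_zero]

/-! ## Pairings of points on the circle -/

theorem pairSum_eq_ite {m n N : ℕ} (s : Fin N → Fin m) (u : Fin N → ℝ) :
    pairSum (n := n) s u = ∑ i : Fin N, ∑ j : Fin N,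
      if i < j then ((u j - u i - 1 / 2 : ℝ) : ℂ) • alphaOp (s j) (s i) else 0 := by
  refine Finset.sum_congr rfl fun i _ => ?_
  rw [← Finset.sum_filter]
  refine Finset.sum_congr (Finset.ext fun j => by simp) fun _ _ => rfl

theorem pairSum_congr {m n N : ℕ} (s : Fin N → Fin m) {u w : Fin N → ℝ}
    (h : ∀ i j, u j - u i = w j - w i) : pairSum (n := n) s u = pairSum s w := by
  simp only [pairSum, h]

/-- Renaming variables keeps the constant coefficient, so it is enough that the exponents are
intertwined on relabelled tensors. The numbers of points may differ, which allows points to be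
dropped. -/
theorem pairIntegrand_congr {m m' n N N' : ℕ} {s : Fin N → Fin m} {s' : Fin N' → Fin m'}
    {u : Fin N → ℝ} {u' : Fin N' → ℝ} (σ : Fin m → Fin m') (f : TensorPoly m n)
    (h : ∀ f : TensorPoly m n, pairSum s' u' (relabel n σ f) = relabel n σ (pairSum s u f)) :
    pairIntegrand s' (relabel n σ f) u' = pairIntegrand s f u := by
  rw [pairIntegrand, pairIntegrand, ← AlgHom.toLinearMap_apply,
    expOp_intertwine (lowersDegree_pairSum s u) (lowersDegree_pairSum s' u') _ h]
  exact MvPolynomial.constantCoeff_rename _ _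

theorem pairIntegrand_congr_pairSum {m n N N' : ℕ} {s : Fin N → Fin m} {s' : Fin N' → Fin m}
    {u : Fin N → ℝ} {u' : Fin N' → ℝ} (f : TensorPoly m n)
    (h : pairSum (n := n) s' u' = pairSum s u) :
    pairIntegrand s' f u' = pairIntegrand s f u := by
  simp only [pairIntegrand, h]

theorem pairIntegrand_relabel {m m' n N : ℕ} {σ : Fin m → Fin m'} (hσ : Function.Injective σ)
    (s : Fin N → Fin m) (f : TensorPoly m n) (u : Fin N → ℝ) :
    pairIntegrand (fun i => σ (s i)) (relabel n σ f) u = pairIntegrand s f u := by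
  refine pairIntegrand_congr σ f fun f => ?_
  simp only [pairSum, LinearMap.sum_apply, LinearMap.smul_apply, alphaOp_relabel hσ, map_sum,
    map_smul]

/-- A point whose tensor factor carries no variable can be removed. -/
theorem pairIntegrand_relabel_removeNth {m m' n N : ℕ} {σ : Fin m → Fin m'}
    (hσ : Function.Injective σ) {s : Fin (N + 1) → Fin m'} {p : Fin (N + 1)} {s₀ : Fin N → Fin m}
    (hs : ∀ i, s (p.succAbove i) = σ (s₀ i)) (hp : ∀ q, s p ≠ σ q) (f : TensorPoly m n)
    (u : Fin (N + 1) → ℝ) :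
    pairIntegrand s (relabel n σ f) u = pairIntegrand s₀ f (p.removeNth u) := by
  refine pairIntegrand_congr σ f fun f => ?_
  simp only [pairSum_eq_ite, LinearMap.sum_apply, map_sum]
  have h0 : ∀ i j : Fin (N + 1), (if i < j then ((u j - u i - 1 / 2 : ℝ) : ℂ) • alphaOp (s j) (s i)
      else (0 : Module.End ℂ (TensorPoly m' n))) (relabel n σ f)
      = if i < j then ((u j - u i - 1 / 2 : ℝ) : ℂ) • alphaOp (s j) (s i) (relabel n σ f)
        else 0 := by
    intro i j; split_ifs <;> simp
  have h1 : ∀ i j : Fin N, (if i < j then ((p.removeNth u j - p.removeNth u i - 1 / 2 : ℝ) : ℂ) •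
      alphaOp (s₀ j) (s₀ i) else (0 : Module.End ℂ (TensorPoly m n))) f
      = if i < j then ((p.removeNth u j - p.removeNth u i - 1 / 2 : ℝ) : ℂ) •
      alphaOp (s₀ j) (s₀ i) f else 0 := by
    intro i j; split_ifs <;> simp
  simp only [h0, h1]
  -- Pairs that contain the point p contribute zero, as α differentiates a factor without variables;
  -- this is used for i = p here and for j = p below.
  rw [Fin.sum_univ_succAbove _ p]
  simp only [alphaOp_relabel_of_notMem hp, smul_zero, ite_self, Finset.sum_const_zero, zero_add]
  refine Finset.sum_congr rfl fun i _ => ?_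
  rw [Fin.sum_univ_succAbove _ p]
  simp only [alphaOp_relabel_of_notMem' hp, smul_zero, ite_self, zero_add]
  refine Finset.sum_congr rfl fun j _ => ?_
  simp only [hs, alphaOp_relabel hσ, (Fin.strictMono_succAbove p).lt_iff_lt, Fin.removeNth]
  split_ifs <;> simp

theorem pairIntegrand_translate {m n N : ℕ} (s : Fin (N + 1) → Fin m) (f : TensorPoly m n)
    (u : Fin (N + 1) → ℝ) :
    pairIntegrand s f (Fin.cons 0 (fun i : Fin N => u i.succ - u 0)) = pairIntegrand s f u := by
  refine pairIntegrand_congr_pairSum f (pairSum_congr s ?_)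
  intro i j
  have h : ∀ i, (Fin.cons 0 (fun i : Fin N => u i.succ - u 0) : Fin (N + 1) → ℝ) i = u i - u 0 := by
    intro i
    refine Fin.cases ?_ (fun i => ?_) i <;> simp
  rw [h, h]; ring

theorem sum_sum_lt_castSucc {M : Type*} [AddCommMonoid M] {N : ℕ} (F : Fin (N + 1) → Fin (N + 1) → M) :
    (∑ i, ∑ j, if i < j then F i j else 0)
      = (∑ i : Fin N, ∑ j : Fin N, if i < j then F i.castSucc j.castSucc else 0)
        + ∑ i : Fin N, F i.castSucc (Fin.last N) := by
  rw [Fin.sum_univ_castSucc, ← Finset.sum_add_distrib]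
  simp only [Fin.sum_univ_castSucc (n := N)]
  simp [(Fin.le_last _).not_gt]

theorem sum_sum_lt_succ {M : Type*} [AddCommMonoid M] {N : ℕ} (F : Fin (N + 1) → Fin (N + 1) → M) :
    (∑ i, ∑ j, if i < j then F i j else 0)
      = (∑ i : Fin N, ∑ j : Fin N, if i < j then F i.succ j.succ else 0)
        + ∑ j : Fin N, F 0 j.succ := by
  rw [Fin.sum_univ_succ, add_comm]
  simp only [Fin.sum_univ_succ (n := N)]
  simp

/-- The pairing only depends on the cyclic configuration of points on the circle. -/
theorem pairSum_finRotate {n N : ℕ} (v : Fin (N + 1) → ℝ) :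
    pairSum (n := n) (fun i => finRotate (N + 2) i) (Fin.cons 0 (rebase v))
      = pairSum (fun i => i) (Fin.cons 0 v) := by
  have h1 : ∀ i : Fin (N + 1), (Fin.cons 0 (rebase v) : Fin (N + 2) → ℝ) i.castSucc
      = v i - v 0 := by
    intro i
    refine Fin.cases ?_ (fun i => ?_) i
    · simp
    · rw [← Fin.succ_castSucc, Fin.cons_succ, rebase, Fin.snoc_castSucc]
  have h2 : (Fin.cons 0 (rebase v) : Fin (N + 2) → ℝ) (Fin.last (N + 1)) = 1 - v 0 := by
    rw [← Fin.succ_last, Fin.cons_succ, rebase, Fin.snoc_last]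
  have h3 : ∀ i : Fin (N + 1), finRotate (N + 2) i.castSucc = i.succ := fun i => by
    rw [finRotate_apply, Fin.coeSucc_eq_succ]
  rw [pairSum_eq_ite, pairSum_eq_ite]
  -- The old base point is the last point on the left and the initial one on the right. Its pairs
  -- are split off on both sides; all other pairs agree because differences are translation
  -- invariant.
  rw [sum_sum_lt_castSucc (fun i j : Fin (N + 2) =>
      (((Fin.cons 0 (rebase v) : Fin (N + 2) → ℝ) j - (Fin.cons 0 (rebase v) : Fin (N + 2) → ℝ) i
        - 1 / 2 : ℝ) : ℂ) • alphaOp (finRotate (N + 2) j) (finRotate (N + 2) i)),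
    sum_sum_lt_succ (fun i j : Fin (N + 2) =>
      (((Fin.cons 0 v : Fin (N + 2) → ℝ) j - (Fin.cons 0 v : Fin (N + 2) → ℝ) i - 1 / 2 : ℝ) : ℂ) •
        alphaOp j i)]
  simp only [h1, h2, h3, finRotate_last, Fin.cons_succ, Fin.cons_zero]
  refine congrArg₂ (· + ·) ?_ ?_
  · simp only [sub_sub_sub_cancel_right]
  · refine Finset.sum_congr rfl fun i _ => ?_
    -- Here B_1(1 - v_i) = -B_1(v_i) compensates the antisymmetry of α.
    rw [alphaOp_swap, smul_neg, ← neg_smul]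
    refine congrArg₂ (· • ·) ?_ rfl
    push_cast
    ring

theorem pairIntegrand_rebase {n N : ℕ} (f : TensorPoly (N + 2) n) (v : Fin (N + 1) → ℝ) :
    pairIntegrand (fun i => i) f (Fin.cons 0 (rebase v))
      = pairIntegrand (fun i => i) (relabel n (finRotate (N + 2)) f) (Fin.cons 0 v) := by
  rw [← pairIntegrand_relabel (finRotate (N + 2)).injective]
  exact pairIntegrand_congr_pairSum _ (pairSum_finRotate v)

/-! ## Pure tensors -/

theorem pureTensor_eq_prod {m n : ℕ} (a : Fin m → MvPolynomial (Fin (2 * n)) ℂ) :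
    pureTensor m n a = ∏ i, MvPolynomial.rename (Prod.mk i) (a i) := by
  simp [pureTensor]

theorem pureTensor_insertNth {m n : ℕ} (p : Fin (m + 1)) (b : MvPolynomial (Fin (2 * n)) ℂ)
    (a : Fin m → MvPolynomial (Fin (2 * n)) ℂ) :
    pureTensor (m + 1) n (Fin.insertNth (α := fun _ => MvPolynomial (Fin (2 * n)) ℂ) p b a)
      = MvPolynomial.rename (Prod.mk p) b * relabel n p.succAbove (pureTensor m n a) := by
  rw [pureTensor_eq_prod, pureTensor_eq_prod, Fin.prod_univ_succAbove _ p, map_prod]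
  simp only [Fin.insertNth_apply_same, Fin.insertNth_apply_succAbove, relabel_rename]

theorem relabel_pureTensor_comp {m n : ℕ} (e : Equiv.Perm (Fin m))
    (a : Fin m → MvPolynomial (Fin (2 * n)) ℂ) :
    relabel n e (pureTensor m n (fun i => a (e i))) = pureTensor m n a := by
  rw [pureTensor_eq_prod, pureTensor_eq_prod, map_prod]
  simp only [relabel_rename]
  exact Equiv.prod_comp e fun i => MvPolynomial.rename (Prod.mk i) (a i)

theorem slotDeriv_pureTensor {m n : ℕ} (a : Fin m → MvPolynomial (Fin (2 * n)) ℂ) (r : Fin m)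
    (x : Fin (2 * n)) : slotDeriv r x (pureTensor m n a)
      = pureTensor m n (Function.update a r (MvPolynomial.pderiv x (a r))) := by
  obtain ⟨m, rfl⟩ : ∃ k, m = k + 1 := ⟨m - 1, by have := r.pos; omega⟩
  have h : Function.update a r (MvPolynomial.pderiv x (a r))
      = Fin.insertNth (α := fun _ => MvPolynomial (Fin (2 * n)) ℂ) r
        (MvPolynomial.pderiv x (a r)) (r.removeNth a) := (Fin.insertNth_removeNth r _ a).symm
  conv_lhs => rw [← Fin.insertNth_self_removeNth r a]
  rw [h, pureTensor_insertNth, pureTensor_insertNth, slotDeriv_mul,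
    slotDeriv_relabel_of_notMem (fun q => (Fin.succAbove_ne r q).symm), mul_zero, add_zero]
  congr 1
  exact MvPolynomial.pderiv_rename (f := Prod.mk r) (fun _ _ h => (Prod.mk.inj h).2) x (a r)

/-! ## Determinants of derivatives -/

/-- The matrix of variables `(r_i, x)`. -/
noncomputable def slotMatrix {m n k : ℕ} (r : Fin k → Fin m) (c : Fin k → Fin (2 * n)) :
    Matrix (Fin k) (Fin k) (TensorPoly m n) :=
  Matrix.of fun i l => MvPolynomial.X (r i, c l)

theorem relabel_det_slotMatrix {m m' n k : ℕ} (σ : Fin m → Fin m') (r : Fin k → Fin m)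
    (c : Fin k → Fin (2 * n)) :
    relabel n σ (slotMatrix r c).det = (slotMatrix (fun i => σ (r i)) c).det := by
  rw [AlgHom.map_det]
  congr 1
  ext1 i l
  simp [slotMatrix]

theorem detDeriv_eq_diffOp (n : ℕ) :
    detDeriv n = diffOp (2 * n + 1) n (slotMatrix Fin.succ id).det := by
  -- `Matrix.det_apply` lets the permutation act on rows and `detDeriv` on columns, hence the
  -- transpose.
  rw [← Matrix.det_transpose, Matrix.det_apply, map_sum, detDeriv]
  refine Finset.sum_congr rfl fun σ _ => ?_
  rw [← List.prod_ofFn, Units.smul_def, map_zsmul, map_list_prod, List.map_ofFn,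
    ← Int.cast_smul_eq_zsmul ℂ]
  simp [slotMatrix, Function.comp_def]

/-! ## The Cartan formula for interior products -/

theorem interiorForm_apply {A : Type*} [Ring A] [Algebra ℂ A] {k : ℕ} (b : A)
    (φ : MultilinearMap ℂ (fun _ : Fin (k + 2) => A) ℂ) (a : Fin (k + 1) → A) :
    interiorForm k b φ a = ∑ j : Fin (k + 1), (-1 : ℂ) ^ (j : ℕ) * φ (insertAfter b j a) := by
  simp [interiorForm, pullTuple_apply]

theorem insertAfter_apply {A : Type*} {k : ℕ} (b : A) (j : Fin (k + 1)) (a : Fin (k + 1) → A)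
    (l : Fin (k + 2)) : insertAfter b j a l
      = if h : (l : ℕ) ≤ j then a ⟨l, by omega⟩ else
        if (l : ℕ) = j + 1 then b else a ⟨l - 1, by omega⟩ := by
  rw [insertAfter]
  refine Fin.succAboveCases j.succ ?_ (fun l => ?_) l
  · simp
  · rw [Fin.insertNth_apply_succAbove]
    by_cases h : l.castSucc < j.succ
    · have h' : (l : ℕ) ≤ j := Nat.lt_succ_iff.1 h
      rw [Fin.succAbove_of_castSucc_lt _ _ h]
      simp [h']
    · have h' : ¬ (l : ℕ) ≤ j := fun h' => h (Nat.lt_succ_iff.2 h')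
      rw [Fin.succAbove_of_le_castSucc _ _ (not_lt.1 h)]
      have h1 : ¬ (l : ℕ) + 1 ≤ j := by omega
      have h2 : (l : ℕ) ≠ j := by omega
      have h3 : (⟨((l.succ : Fin (k + 2)) : ℕ) - 1, by omega⟩ : Fin (k + 1)) = l := by ext; simp
      rw [dif_neg (by simpa using h1), if_neg (by simpa using h2), h3]

theorem mulFace_apply {A : Type*} [Ring A] {k : ℕ} (i : Fin (k + 1)) (a : Fin (k + 2) → A)
    (l : Fin (k + 1)) : mulFace i a l = if (l : ℕ) < i then a ⟨l, by omega⟩ else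
      if (l : ℕ) = i then a ⟨l, by omega⟩ * a ⟨l + 1, by omega⟩ else a ⟨l + 1, by omega⟩ := by
  rfl

theorem mulFace_insertAfter_of_le {A : Type*} [Ring A] {k : ℕ} (b : A) {i j : Fin (k + 1)}
    (h : i ≤ j) (a : Fin (k + 2) → A) :
    mulFace i.castSucc (insertAfter b j.succ a) = insertAfter b j (mulFace i a) := by
  funext l
  simp only [mulFace_apply, insertAfter_apply, Fin.val_castSucc, Fin.val_succ]
  grind

theorem mulFace_insertAfter_of_lt {A : Type*} [Ring A] {k : ℕ} (b : A) {i j : Fin (k + 1)}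
    (h : j < i) (a : Fin (k + 2) → A) :
    mulFace i.succ (insertAfter b j.castSucc a) = insertAfter b j (mulFace i a) := by
  funext l
  simp only [mulFace_apply, insertAfter_apply, Fin.val_castSucc, Fin.val_succ]
  grind

theorem mulFace_insertAfter_self {A : Type*} [Ring A] {k : ℕ} (b : A) (i : Fin (k + 1))
    (a : Fin (k + 1) → A) :
    mulFace i (insertAfter b i a) = Function.update a i (a i * b) := by
  funext l
  simp only [mulFace_apply, insertAfter_apply, Function.update_apply, Fin.ext_iff]
  grind

theorem mulFace_insertAfter_succ {A : Type*} [Ring A] {k : ℕ} (b : A) (i : Fin (k + 1))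
    (a : Fin (k + 2) → A) :
    mulFace i.succ (insertAfter b i.castSucc a) = Function.update a i.succ (b * a i.succ) := by
  funext l
  simp only [mulFace_apply, insertAfter_apply, Function.update_apply, Fin.ext_iff, Fin.val_castSucc,
    Fin.val_succ]
  grind

theorem wrapFace_apply {A : Type*} [Ring A] {k : ℕ} (a : Fin (k + 2) → A) (l : Fin (k + 1)) :
    wrapFace a l = if (l : ℕ) = 0 then
      a ⟨k + 1, by omega⟩ * a ⟨0, by omega⟩ else a ⟨l, by omega⟩ := by
  refine Fin.cases ?_ (fun l => ?_) l
  · simp [wrapFace, Fin.last]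
  · simp [wrapFace, Fin.castSucc, Fin.castAdd, Fin.castLE]

theorem wrapFace_insertAfter_castSucc {A : Type*} [Ring A] {k : ℕ} (b : A) (j : Fin (k + 1))
    (a : Fin (k + 2) → A) :
    wrapFace (insertAfter b j.castSucc a) = insertAfter b j (wrapFace a) := by
  funext l
  simp only [wrapFace_apply, insertAfter_apply, Fin.val_castSucc]
  grind

theorem wrapFace_insertAfter_last {A : Type*} [Ring A] {k : ℕ} (b : A) (a : Fin (k + 1) → A) :
    wrapFace (insertAfter b (Fin.last k) a) = Function.update a 0 (b * a 0) := by
  funext l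
  simp only [wrapFace_apply, insertAfter_apply, Function.update_apply, Fin.ext_iff, Fin.val_last,
    Fin.val_zero]
  grind

/-- Meant for i the position of a product and j the position of an insertion. On the diagonal the
product is a_i b, just below it is b a_{i+1}. In the remaining terms b is not multiplied, and the
reindexing matches them with products taken before the insertion. -/
theorem sum_sum_eq_diag_add {k : ℕ} (G : Fin (k + 2) → Fin (k + 2) → ℂ) :
    ∑ i, ∑ j, G i j = ∑ i, G i i + ∑ i : Fin (k + 1), G i.succ i.castSucc
      + ∑ i : Fin (k + 1), ∑ j : Fin (k + 1),
        if i ≤ j then G i.castSucc j.succ else G i.succ j.castSucc := by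
  have h1 : ∑ i, ∑ j, G i j = ∑ i, G i i + (∑ i, ∑ j, if i < j then G i j else 0)
      + ∑ i, ∑ j, if j < i then G i j else 0 := by
    rw [← Finset.sum_add_distrib, ← Finset.sum_add_distrib]
    refine Finset.sum_congr rfl fun i _ => ?_
    have : G i i = ∑ j, if j = i then G i j else 0 := by simp
    rw [this, ← Finset.sum_add_distrib, ← Finset.sum_add_distrib]
    refine Finset.sum_congr rfl fun j _ => ?_
    rcases lt_trichotomy i j with h | h | h
    · simp [h, h.ne', h.not_gt]
    · simp [h]
    · simp [h, h.ne, h.not_gt]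
  have h2 : (∑ i, ∑ j, if i < j then G i j else 0)
      = ∑ i : Fin (k + 1), ∑ j : Fin (k + 1), if i ≤ j then G i.castSucc j.succ else 0 := by
    rw [Fin.sum_univ_castSucc]
    simp only [Fin.sum_univ_succ (n := k + 1), (Fin.le_last _).not_gt, Fin.castSucc_lt_succ_iff,
      Fin.not_lt_zero, if_false, zero_add, Finset.sum_const_zero, add_zero]
  have h3 : (∑ i, ∑ j, if j < i then G i j else 0)
      = ∑ i : Fin (k + 1), ∑ j : Fin (k + 1), if j ≤ i then G i.succ j.castSucc else 0 := by
    rw [Fin.sum_univ_succ]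
    simp only [Fin.sum_univ_castSucc (n := k + 1), (Fin.le_last _).not_gt, Fin.castSucc_lt_succ_iff,
      Fin.not_lt_zero, if_false, zero_add, Finset.sum_const_zero, add_zero]
  rw [h1, h2, h3, add_assoc, add_assoc]
  congr 1
  rw [← Finset.sum_add_distrib, ← Finset.sum_add_distrib]
  refine Finset.sum_congr rfl fun i _ => ?_
  have : G i.succ i.castSucc = ∑ j : Fin (k + 1), if j = i then G i.succ j.castSucc else 0 := by
    simp
  rw [this, ← Finset.sum_add_distrib, ← Finset.sum_add_distrib]
  refine Finset.sum_congr rfl fun j _ => ?_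
  rcases lt_trichotomy i j with h | h | h
  · simp [h.le, h.ne', h.not_ge]
  · simp [h, add_comm]
  · simp [h.le, h.ne, h.not_ge]

/-- Cartan's formula: `d ι_b + ι_b d` is the action of the derivation `a ↦ a b - b a`. -/
theorem hochschildForm_interiorForm {A : Type*} [Ring A] [Algebra ℂ A] {k : ℕ} (b : A)
    (φ : MultilinearMap ℂ (fun _ : Fin (k + 2) => A) ℂ) (a : Fin (k + 2) → A) :
    hochschildForm k (interiorForm k b φ) a + interiorForm (k + 1) b (hochschildForm (k + 1) φ) a
      = ∑ i, φ (Function.update a i (a i * b - b * a i)) := by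
  have hR : ∑ i, φ (Function.update a i (a i * b - b * a i))
      = ∑ i, φ (Function.update a i (a i * b)) - (φ (Function.update a 0 (b * a 0))
        + ∑ i : Fin (k + 1), φ (Function.update a i.succ (b * a i.succ))) := by
    rw [← Fin.sum_univ_succ (fun i => φ (Function.update a i (b * a i))), ← Finset.sum_sub_distrib]
    refine Finset.sum_congr rfl fun i _ => ?_
    rw [MultilinearMap.map_update_sub]
  have hpar : ∀ i : ℕ, (-1 : ℂ) ^ i * (-1) ^ i = 1 := fun i => by rw [← mul_pow]; simp
  rw [hR, hochschildForm_apply, interiorForm_apply]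
  simp only [hochschildForm_apply, interiorForm_apply, mul_add, Finset.sum_add_distrib,
    Finset.mul_sum]
  -- In the wrap-around sum the insertion at the very end is split off: there b wraps onto a_0,
  -- which supplies the missing term with b a_0.
  rw [Finset.sum_comm (s := (Finset.univ : Finset (Fin (k + 1 + 1)))), sum_sum_eq_diag_add,
    Fin.sum_univ_castSucc (f := fun i : Fin (k + 1 + 1) => (-1 : ℂ) ^ (i : ℕ) * ((-1) ^ (k + 1 + 1) *
      φ (wrapFace (insertAfter b i a))))]
  simp only [mulFace_insertAfter_self, mulFace_insertAfter_succ, wrapFace_insertAfter_castSucc,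
    wrapFace_insertAfter_last, Fin.val_succ, Fin.val_castSucc, Fin.val_last]
  -- Exactly one of the two positions is shifted by one, so these terms cancel against those of d
  -- ι_b.
  have h1 : (∑ i : Fin (k + 1), ∑ j : Fin (k + 1), if i ≤ j then
      (-1 : ℂ) ^ ((j : ℕ) + 1) * ((-1) ^ (i : ℕ) *
        φ (mulFace i.castSucc (insertAfter b j.succ a)))
      else (-1 : ℂ) ^ (j : ℕ) * ((-1) ^ ((i : ℕ) + 1) *
        φ (mulFace i.succ (insertAfter b j.castSucc a))))
      = -∑ i : Fin (k + 1), ∑ j : Fin (k + 1), (-1 : ℂ) ^ (i : ℕ) * ((-1) ^ (j : ℕ) *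
        φ (insertAfter b j (mulFace i a))) := by
    rw [← Finset.sum_neg_distrib]
    refine Finset.sum_congr rfl fun i _ => ?_
    rw [← Finset.sum_neg_distrib]
    refine Finset.sum_congr rfl fun j _ => ?_
    split_ifs with h
    · rw [mulFace_insertAfter_of_le b h]; ring
    · rw [mulFace_insertAfter_of_lt b (not_le.1 h)]; ring
  rw [h1]
  simp only [← mul_assoc, hpar, one_mul, pow_succ, mul_neg, mul_one, neg_mul, neg_neg,
    Finset.sum_neg_distrib]
  simp only [mul_comm ((-1 : ℂ) ^ k)]
  ring

/-- On normalized cochains, the interior product with `c` commutes with the action of the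
derivation `a ↦ a b - b a` if `c b - b c` is a scalar. -/
theorem interiorForm_derivation {A : Type*} [Ring A] [Algebra ℂ A] {k : ℕ} (b c : A) (t : ℂ)
    (hbc : c * b - b * c = t • 1) {φ : MultilinearMap ℂ (fun _ : Fin (k + 2) => A) ℂ}
    (hφ : φ ∈ NormCochain A (k + 1)) (a : Fin (k + 1) → A) :
    ∑ j : Fin (k + 1), (-1 : ℂ) ^ (j : ℕ) * ∑ i, φ (Function.update (insertAfter c j a) i
        (insertAfter c j a i * b - b * insertAfter c j a i))
      = ∑ i, interiorForm k c φ (Function.update a i (a i * b - b * a i)) := by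
  simp only [interiorForm_apply]
  rw [Finset.sum_comm (γ := Fin (k + 1))]
  refine Finset.sum_congr rfl fun j _ => ?_
  rw [← Finset.mul_sum, Fin.sum_univ_succAbove _ j.succ]
  congr 1
  simp only [insertAfter, Fin.insertNth_apply_same, Fin.insertNth_apply_succAbove, hbc,
    Fin.insertNth_update]
  -- When the derivation hits the inserted c, it puts a scalar into slot j + 1, which is not slot 0;
  -- normalization kills the term.
  rw [MultilinearMap.map_update_smul, hφ _ j.succ (Fin.succ_ne_zero j) (by simp), smul_zero,
    zero_add]

/-! ## Commutators with coordinates in the Weyl algebra -/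

/-- Antisymmetry of α_{01}. A commutator is therefore twice the part of the product that is odd in
ε; for a coordinate, only the Poisson bracket is left. -/
theorem moyal_swap {n : ℕ} (ε : ℤˣ) (a b : MvPolynomial (Fin (2 * n)) ℂ) :
    moyal n ε a b = moyal n (-ε) b a := by
  have h : pureTensor 2 n ![a, b] = relabel n (Equiv.swap (0 : Fin 2) 1) (pureTensor 2 n ![b, a]) := by
    rw [← relabel_pureTensor_comp (Equiv.swap (0 : Fin 2) 1) ![a, b]]
    congr 2
  have hd : ∀ f : TensorPoly 2 n, diagMul n (relabel n (Equiv.swap (0 : Fin 2) 1) f) = diagMul n f := by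
    intro f
    rw [diagMul, relabel, MvPolynomial.rename_rename]
    rfl
  rw [moyal, moyal, h, ← AlgHom.toLinearMap_apply (relabel n _),
    expOp_intertwine (lowersDegree_moyal n (-ε)) (lowersDegree_moyal n ε), AlgHom.toLinearMap_apply, hd]
  intro f
  have h2 := alphaOp_relabel (n := n) (Equiv.swap (0 : Fin 2) 1).injective 1 0 f
  rw [Equiv.swap_apply_right, Equiv.swap_apply_left] at h2
  rw [LinearMap.smul_apply, AlgHom.toLinearMap_apply, h2, alphaOp_swap]
  simp [neg_div]

theorem moyal_X_left {n : ℕ} (ε : ℤˣ) (x : Fin (2 * n)) (b : MvPolynomial (Fin (2 * n)) ℂ) :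
    moyal n ε (MvPolynomial.X x) b = leftCoord ε x b := by
  have h : leftCoord ε x (1 : MvPolynomial (Fin (2 * n)) ℂ) = MvPolynomial.X x := by
    simp [leftCoord, ham]
  rw [← h, moyal_leftCoord, moyal_one_left]

theorem Weyl.commutator_coord {n : ℕ} {ε : ℤˣ} (x : Fin (2 * n)) (a : Weyl n ε) :
    a * Weyl.poly.symm (MvPolynomial.X x) - Weyl.poly.symm (MvPolynomial.X x) * a
      = Weyl.poly.symm (-((ε : ℤ) : ℂ) • ham x a.poly) := by
  have h1 : a * Weyl.poly.symm (MvPolynomial.X x)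
      = Weyl.poly.symm (moyal n ε a.poly (MvPolynomial.X x)) := rfl
  have h2 : Weyl.poly.symm (MvPolynomial.X x) * a
      = Weyl.poly.symm (moyal n ε (MvPolynomial.X x) a.poly) := rfl
  rw [h1, h2, moyal_swap ε a.poly, moyal_X_left, moyal_X_left, ← map_sub]
  congr 1
  simp only [leftCoord, Units.val_neg, Int.cast_neg]
  module

theorem pIdx_ne_qIdx {n : ℕ} (i j : Fin n) : pIdx i ≠ qIdx j := by
  simp only [pIdx, qIdx, Ne, Fin.ext_iff]
  omega

theorem ham_pIdx {n : ℕ} (j : Fin n) (f : MvPolynomial (Fin (2 * n)) ℂ) :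
    ham (pIdx j) f = MvPolynomial.pderiv (qIdx j) f := by
  have h : ∀ i : Fin n, pIdx j = pIdx i ↔ j = i := fun i => by
    simp [pIdx, Fin.ext_iff]
  simp [ham, h, pIdx_ne_qIdx]

theorem ham_qIdx {n : ℕ} (j : Fin n) (f : MvPolynomial (Fin (2 * n)) ℂ) :
    ham (qIdx j) f = -MvPolynomial.pderiv (pIdx j) f := by
  have h : ∀ i : Fin n, qIdx j = qIdx i ↔ j = i := fun i => by
    simp [qIdx, Fin.ext_iff]
  simp [ham, h, (pIdx_ne_qIdx _ _).symm]

theorem sum_pIdx_add_qIdx {M : Type*} [AddCommMonoid M] {n : ℕ} (F : Fin (2 * n) → M) :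
    ∑ j : Fin n, (F (pIdx j) + F (qIdx j)) = ∑ x, F x := by
  rw [← (finProdFinEquiv.trans (finCongr (Nat.mul_comm n 2))).sum_comp, Fintype.sum_prod_type]
  refine Finset.sum_congr rfl fun j _ => ?_
  rw [Fin.sum_univ_two]
  congr 2 <;> simp [pIdx, qIdx, Fin.ext_iff, finProdFinEquiv]
  omega

/-- The derivative with respect to a coordinate. -/
noncomputable def Weyl.deriv {n : ℕ} {ε : ℤˣ} (x : Fin (2 * n)) (a : Weyl n ε) : Weyl n ε :=
  Weyl.poly.symm (MvPolynomial.pderiv x a.poly)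

theorem Weyl.commutator_p {n : ℕ} {ε : ℤˣ} (j : Fin n) (a : Weyl n ε) :
    a * Weyl.p j - Weyl.p j * a = -((ε : ℤ) : ℂ) • Weyl.deriv (qIdx j) a := by
  rw [Weyl.p, Weyl.commutator_coord, ham_pIdx, map_smul]
  rfl

theorem Weyl.commutator_q {n : ℕ} {ε : ℤˣ} (j : Fin n) (a : Weyl n ε) :
    a * Weyl.q j - Weyl.q j * a = ((ε : ℤ) : ℂ) • Weyl.deriv (pIdx j) a := by
  rw [Weyl.q, Weyl.commutator_coord, ham_qIdx, smul_neg, neg_smul, neg_neg, map_smul]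
  rfl

theorem Weyl.commutator_p_q {n : ℕ} {ε : ℤˣ} (j : Fin n) :
    (Weyl.p j : Weyl n ε) * Weyl.q j - Weyl.q j * Weyl.p j = ((ε : ℤ) : ℂ) • (1 : Weyl n ε) := by
  rw [Weyl.commutator_q, Weyl.deriv, Weyl.p, LinearEquiv.apply_symm_apply,
    MvPolynomial.pderiv_X_self]
  rfl

/-- `L_ω` is `-ε` times the contraction of the interior products with the coordinates and the
derivatives along the coordinates. -/
theorem LOmega_apply {n : ℕ} {ε : ℤˣ} {k : ℕ} (φ : NormCochain (Weyl n ε) (k + 2))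
    (a : Fin (k + 2) → Weyl n ε) :
    (LOmega n ε k φ).1 a = -((ε : ℤ) : ℂ) * ∑ x : Fin (2 * n), ∑ i,
      interiorForm (k + 1) (Weyl.poly.symm (MvPolynomial.X x)) φ.1
        (Function.update a i (Weyl.deriv x (a i))) := by
  have h0 : (LOmega n ε k φ).1 a = ∑ j : Fin n,
      (hochschildForm k (interiorForm k (Weyl.p j) (interiorForm (k + 1) (Weyl.q j) φ.1)) a
        - interiorForm (k + 1) (Weyl.p j) (interiorForm (k + 2) (Weyl.q j)
          (hochschildForm (k + 2) φ.1)) a) := by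
    have e1 : (LOmega n ε k φ).1 = hochschildForm k (∑ j : Fin n, (interiorForm k (Weyl.p j)
        (interiorForm (k + 1) (Weyl.q j) φ.1))) - ∑ j : Fin n, interiorForm (k + 1) (Weyl.p j)
        (interiorForm (k + 2) (Weyl.q j) (hochschildForm (k + 2) φ.1)) := by
      simp [LOmega, iotaOmega, hochschildD, hochInterior]
    rw [e1, map_sum, ← Finset.sum_sub_distrib]
    simp
  rw [h0, ← sum_pIdx_add_qIdx, Finset.mul_sum]
  refine Finset.sum_congr rfl fun j _ => ?_
  -- Cartan's formula for p on ι_q φ, and in `h2` for q under ι_p, with L_q moved to the left of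
  -- ι_p. The mixed term ι_p d ι_q φ drops out of `h1 - h2`.
  have h1 := hochschildForm_interiorForm (Weyl.p j) (interiorForm (k + 1) (Weyl.q j) φ.1) a
  have h2 : interiorForm (k + 1) (Weyl.p j) (hochschildForm (k + 1)
        (interiorForm (k + 1) (Weyl.q j) φ.1)) a
      + interiorForm (k + 1) (Weyl.p j) (interiorForm (k + 2) (Weyl.q j)
          (hochschildForm (k + 2) φ.1)) a
      = ∑ i, interiorForm (k + 1) (Weyl.p j) φ.1
          (Function.update a i (a i * Weyl.q j - Weyl.q j * a i)) := by
    rw [← interiorForm_derivation _ _ _ (Weyl.commutator_p_q j) φ.2, interiorForm_apply,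
      interiorForm_apply, ← Finset.sum_add_distrib]
    refine Finset.sum_congr rfl fun i _ => ?_
    rw [← mul_add, hochschildForm_interiorForm]
  simp only [Weyl.commutator_p, Weyl.commutator_q, MultilinearMap.map_update_smul, smul_eq_mul,
    ← Finset.mul_sum] at h1 h2
  have e1 : (Weyl.p j : Weyl n ε) = Weyl.poly.symm (MvPolynomial.X (pIdx j)) := rfl
  have e2 : (Weyl.q j : Weyl n ε) = Weyl.poly.symm (MvPolynomial.X (qIdx j)) := rfl
  rw [← e1, ← e2]
  linear_combination h1 - h2

/-! ## The interior products of the cochain with the coordinates -/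

theorem det_slotMatrix_submatrix {m n k l : ℕ} (r : Fin k → Fin m) (c : Fin k → Fin (2 * n))
    (e f : Fin l → Fin k) :
    (slotMatrix (n := n) r c).submatrix e f = slotMatrix (fun i => r (e i)) (fun i => c (f i)) := rfl

theorem slotDeriv_coord_mul_relabel {m n : ℕ} (p : Fin (m + 1)) (x y : Fin (2 * n))
    (g : TensorPoly m n) :
    slotDeriv p x (MvPolynomial.rename (Prod.mk p) (MvPolynomial.X y) * relabel n p.succAbove g)
      = if x = y then relabel n p.succAbove g else 0 := by
  rw [slotDeriv_mul, slotDeriv_relabel_of_notMem (fun q => (Fin.succAbove_ne p q).symm), mul_zero,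
    add_zero, MvPolynomial.rename_X]
  split_ifs with h
  · subst h; simp [slotDeriv]
  · have : ((p, y) : Fin (m + 1) × Fin (2 * n)) ≠ (p, x) := fun e => h (Prod.mk.inj e).2.symm
    simp [slotDeriv, MvPolynomial.pderiv_X_of_ne this]

theorem diffOp_mul_apply {m n : ℕ} (P Q f : TensorPoly m n) :
    diffOp m n (P * Q) f = diffOp m n P (diffOp m n Q f) := by
  rw [map_mul, Module.End.mul_apply]

/-- The factor j + 1 contains only the variable y_{c l}, and row j of the determinant differentiates
it. In the Laplace expansion along this row only column l survives, as c is injective. -/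
theorem diffOp_det_coord_mul_relabel {n N : ℕ} {c : Fin (N + 1) → Fin (2 * n)}
    (hc : Function.Injective c) (j l : Fin (N + 1)) (g : TensorPoly (N + 1) n) :
    diffOp (N + 2) n (slotMatrix Fin.succ c).det
        (MvPolynomial.rename (Prod.mk j.succ) (MvPolynomial.X (c l))
          * relabel n j.succ.succAbove g)
      = (-1 : ℂ) ^ (j + l : ℕ) • relabel n j.succ.succAbove
          (diffOp (N + 1) n (slotMatrix Fin.succ (fun i => c (l.succAbove i))).det g) := by
  have h : ∀ l' : Fin (N + 1), diffOp (N + 2) n ((-1) ^ (j + l' : ℕ) * slotMatrix Fin.succ c j l'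
        * ((slotMatrix Fin.succ c).submatrix j.succAbove l'.succAbove).det)
      (MvPolynomial.rename (Prod.mk j.succ) (MvPolynomial.X (c l)) * relabel n j.succ.succAbove g)
      = if l' = l then (-1 : ℂ) ^ (j + l : ℕ) • relabel n j.succ.succAbove
          (diffOp (N + 1) n (slotMatrix Fin.succ (fun i => c (l.succAbove i))).det g) else 0 := by
    intro l'
    have e : slotMatrix (m := N + 2) (n := n) Fin.succ c j l' = MvPolynomial.X (j.succ, c l') := rfl
    -- The rows of the minor avoid the factor j + 1, so the minor is relabelled from a tensor with
    -- one factor fewer.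
    have e' : slotMatrix (n := n) (fun i : Fin N => (j.succAbove i).succ) (fun i => c (l'.succAbove i))
        = slotMatrix (fun i : Fin N => j.succ.succAbove i.succ) (fun i => c (l'.succAbove i)) := by
      simp only [Fin.succ_succAbove_succ]
    rw [mul_right_comm, e, diffOp_mul_apply, diffOp_X, slotDeriv_coord_mul_relabel]
    by_cases hl : l' = l
    · subst hl
      rw [if_pos rfl, if_pos rfl, det_slotMatrix_submatrix, e', ← relabel_det_slotMatrix,
        diffOp_mul_apply, diffOp_relabel Fin.succAbove_right_injective]
      rcases Nat.even_or_odd (j + l' : ℕ) with hp | hp <;> simp [hp.neg_one_pow]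
    · rw [if_neg (fun e => hl (hc e)), if_neg hl, map_zero]
  rw [Matrix.det_succ_row _ j, map_sum, LinearMap.sum_apply, Finset.sum_congr rfl fun l' _ => h l']
  simp

theorem succ_removeNth_cons {N : ℕ} (j : Fin (N + 1)) (t : ℝ) (u : Fin (N + 1) → ℝ) :
    j.succ.removeNth (Fin.cons t u : Fin (N + 2) → ℝ)
      = (Fin.cons t (j.removeNth u) : Fin (N + 1) → ℝ) := by
  funext i
  refine Fin.cases ?_ (fun i => ?_) i
  · simp [Fin.removeNth]
  · simp [Fin.removeNth, Fin.succ_succAbove_succ]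

theorem continuous_cons_zero (N : ℕ) :
    Continuous fun v : Fin N → ℝ => (Fin.cons 0 v : Fin (N + 1) → ℝ) := by
  refine continuous_pi fun i => Fin.cases ?_ (fun i => ?_) i
  · simpa using continuous_const
  · simpa using continuous_apply i

theorem continuous_pairIntegrand_cons {m n N : ℕ} (s : Fin (N + 1) → Fin m) (f : TensorPoly m n) :
    Continuous fun v : Fin N → ℝ => pairIntegrand s f (Fin.cons 0 v) :=
  (continuous_pairIntegrand s f).comp (continuous_cons_zero N)

theorem pairIntegral_apply {m n N : ℕ} (s : Fin (N + 1) → Fin m) (f : TensorPoly m n) :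
    pairIntegral s f = ∫ v in ordSimplex N, pairIntegrand s f (Fin.cons 0 v) := rfl

/-- The sign (-1)^j of the interior product removes the j-dependence of the cofactor sign
(-1)^{j+l}. The inserted factor has become constant, and summing over j lets its point run through
all gaps, which integrates to 1. -/
theorem sum_pairIntegral_coord_mul_relabel {n N : ℕ} {c : Fin (N + 1) → Fin (2 * n)}
    (hc : Function.Injective c) (l : Fin (N + 1)) (g : TensorPoly (N + 1) n) :
    ∑ j : Fin (N + 1), (-1 : ℂ) ^ (j : ℕ) * pairIntegral (fun i : Fin (N + 2) => i)
        (diffOp (N + 2) n (slotMatrix Fin.succ c).det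
          (MvPolynomial.rename (Prod.mk j.succ) (MvPolynomial.X (c l))
            * relabel n j.succ.succAbove g))
      = (-1 : ℂ) ^ (l : ℕ) * pairIntegral (fun i : Fin (N + 1) => i)
          (diffOp (N + 1) n (slotMatrix Fin.succ (fun i => c (l.succAbove i))).det g) := by
  set f := diffOp (N + 1) n (slotMatrix Fin.succ (fun i => c (l.succAbove i))).det g
  have h : ∀ j : Fin (N + 1), pairIntegral (fun i : Fin (N + 2) => i) (relabel n j.succ.succAbove f)
      = ∫ u in ordSimplex (N + 1),
        (fun v : Fin N → ℝ => pairIntegrand (fun i => i) f (Fin.cons 0 v)) (j.removeNth u) := by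
    intro j
    rw [pairIntegral_apply]
    refine MeasureTheory.integral_congr_ae (Filter.Eventually.of_forall fun u => ?_)
    simp only
    rw [pairIntegrand_relabel_removeNth Fin.succAbove_right_injective (p := j.succ)
      (s₀ := fun i => i) (fun _ => rfl) (fun q => (Fin.succAbove_ne j.succ q).symm),
      succ_removeNth_cons]
  simp only [diffOp_det_coord_mul_relabel hc, map_smul, smul_eq_mul]
  change ∑ j : Fin (N + 1), (-1 : ℂ) ^ (j : ℕ) * ((-1) ^ (j + l : ℕ) *
    pairIntegral (fun i : Fin (N + 2) => i) (relabel n j.succ.succAbove f)) = _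
  simp only [h]
  rw [pairIntegral_apply, ← sum_setIntegral_removeNth (continuous_pairIntegrand_cons _ f),
    Finset.mul_sum]
  refine Finset.sum_congr rfl fun j _ => ?_
  rw [← mul_assoc, pow_add, ← mul_assoc, ← mul_pow]
  simp

/-! ### Resummation of the minors. -/

/-- Laplace expansion along the sum of all rows. -/
theorem sum_totalDeriv_mul_det {n N : ℕ} (c : Fin (N + 1) → Fin (2 * n)) :
    ∑ l : Fin (N + 1), (-1 : TensorPoly (N + 1) n) ^ (l : ℕ)
        * ∑ i : Fin (N + 1), MvPolynomial.X (i, c l)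
        * (slotMatrix Fin.succ (fun i => c (l.succAbove i))).det
      = (slotMatrix (fun i => i) c).det := by
  -- Replacing row 0 by the sum of all rows leaves the determinant unchanged.
  have h := Matrix.det_updateRow_sum (slotMatrix (n := n) (fun i : Fin (N + 1) => i) c) 0 fun _ => 1
  rw [one_smul] at h
  rw [← h, Matrix.det_succ_row_zero]
  refine Finset.sum_congr rfl fun l _ => ?_
  rw [← Finset.sum_mul, ← mul_assoc]
  congr 2
  exact (Finset.sum_apply l Finset.univ
    fun (k : Fin (N + 1)) (l : Fin (N + 1)) => (MvPolynomial.X (k, c l) : TensorPoly (N + 1) n)).symm.trans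
    (by simp only [one_smul]; rfl)

/-- Differentiating the i-th entry along y_{c l} is the operator with symbol X_{(i, c l)}; summed
over i, these symbols form the row in the expansion of `sum_totalDeriv_mul_det`. -/
theorem sum_pairIntegral_update {n N : ℕ} (c : Fin (N + 1) → Fin (2 * n))
    (b : Fin (N + 1) → MvPolynomial (Fin (2 * n)) ℂ) :
    ∑ l : Fin (N + 1), ∑ i : Fin (N + 1), (-1 : ℂ) ^ (l : ℕ) * pairIntegral (fun i : Fin (N + 1) => i)
        (diffOp (N + 1) n (slotMatrix Fin.succ (fun i => c (l.succAbove i))).det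
          (pureTensor (N + 1) n (Function.update b i (MvPolynomial.pderiv (c l) (b i)))))
      = pairIntegral (fun i : Fin (N + 1) => i)
          (diffOp (N + 1) n (slotMatrix (fun i => i) c).det (pureTensor (N + 1) n b)) := by
  rw [← sum_totalDeriv_mul_det, map_sum, LinearMap.sum_apply, map_sum]
  refine Finset.sum_congr rfl fun l _ => ?_
  rw [Finset.mul_sum, map_sum, LinearMap.sum_apply, map_sum]
  refine Finset.sum_congr rfl fun i _ => ?_
  rw [← slotDeriv_pureTensor, ← diffOp_X (i, c l), ← Module.End.mul_apply, ← map_mul,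
    mul_comm (MvPolynomial.X _), map_mul (diffOp (N + 1) n) ((-1) ^ _), Module.End.mul_apply]
  rcases Nat.even_or_odd (l : ℕ) with hp | hp <;> simp [hp.neg_one_pow]

/-! ## Rotations of the circle -/

/-- Relabelling undoes the rotation of the tensor but rotates the N + 1 rows of the determinant, a
cycle of sign (-1)^N. -/
theorem relabel_finRotate_det {n N : ℕ} (c : Fin (N + 1) → Fin (2 * n))
    (b : Fin (N + 1) → MvPolynomial (Fin (2 * n)) ℂ) :
    relabel n (finRotate (N + 1)) (diffOp (N + 1) n (slotMatrix (fun i => i) c).det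
        (pureTensor (N + 1) n (fun i => b (finRotate (N + 1) i))))
      = (-1 : ℂ) ^ N • diffOp (N + 1) n (slotMatrix (fun i => i) c).det (pureTensor (N + 1) n b) := by
  rw [← diffOp_relabel (finRotate (N + 1)).injective, relabel_pureTensor_comp,
    relabel_det_slotMatrix]
  have h := Matrix.det_permute (finRotate (N + 1)) (slotMatrix (n := n) (fun i : Fin (N + 1) => i) c)
  rw [det_slotMatrix_submatrix] at h
  rw [show (slotMatrix (n := n) (fun i => finRotate (N + 1) i) c)
    = slotMatrix (fun i => finRotate (N + 1) i) (fun i => c (id i)) from rfl, h, sign_finRotate]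
  rcases Nat.even_or_odd N with hp | hp <;> simp [hp.neg_one_pow]

/-- Integrating over the position of the base point. -/
theorem setIntegral_pairIntegrand {m n N : ℕ} (s : Fin (N + 2) → Fin m) (f : TensorPoly m n) :
    ∫ u in ordSimplex (N + 2), pairIntegrand s f u
      = ∫ v in ordSimplex (N + 1), ((1 - v (Fin.last N) : ℝ) : ℂ) *
          pairIntegrand s f (Fin.cons 0 v) := by
  -- The coordinate integrated out is the last one after `rebase`, that is 1 - u_0. The others
  -- become the differences u_{i+1} - u_0, which give the same integrand by translation invariance.
  have h := setIntegral_removeNth (Fin.last (N + 1)) (continuous_pairIntegrand_cons s f)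
  simp only [Fin.succ_last, withEnds_last] at h
  rw [← setIntegral_comp_rebase (F := fun u => pairIntegrand s f
    (Fin.cons 0 ((Fin.last (N + 1)).removeNth u))) ((continuous_pairIntegrand_cons s f).comp
    (continuous_pi fun i => continuous_apply _))] at h
  simp only [← Fin.succ_last N, withEnds_succ_castSucc] at h
  rw [← h]
  refine MeasureTheory.integral_congr_ae (Filter.Eventually.of_forall fun u => ?_)
  simp only
  rw [← pairIntegrand_translate]
  congr 2
  simp [rebase]

theorem ofNat_succ_add {N : ℕ} (j : ℕ) (i : Fin (N + 2)) :
    Fin.ofNat (N + 2) (j + 1) + i = Fin.ofNat (N + 2) j + finRotate (N + 2) i := by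
  rw [finRotate_apply, add_comm i, ← add_assoc]
  congr 1
  ext
  simp [Fin.val_add]

/-- The summands of Connes' operator cover the configurations of points on the circle. -/
theorem sum_setIntegral_rotate {n N : ℕ} (c : Fin (N + 2) → Fin (2 * n))
    (b : Fin (N + 2) → MvPolynomial (Fin (2 * n)) ℂ) :
    ∑ j : Fin (N + 2), (-1 : ℂ) ^ ((N + 1) * (j : ℕ)) * ∫ u in ordSimplex (N + 2),
        pairIntegrand (fun i => i) (diffOp (N + 2) n (slotMatrix (fun i => i) c).det
          (pureTensor (N + 2) n (fun i => b (j + i)))) u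
      = pairIntegral (fun i : Fin (N + 2) => i)
          (diffOp (N + 2) n (slotMatrix (fun i => i) c).det (pureTensor (N + 2) n b)) := by
  -- The rotated tensors are indexed by natural numbers to permit induction on the number of
  -- rotations.
  obtain ⟨f, hf⟩ : ∃ f : ℕ → TensorPoly (N + 2) n, ∀ j, f j = diffOp (N + 2) n
      (slotMatrix (fun i => i) c).det (pureTensor (N + 2) n (fun i => b (Fin.ofNat (N + 2) j + i))) :=
    ⟨_, fun _ => rfl⟩
  have hstep : ∀ j, relabel n (finRotate (N + 2)) (f (j + 1)) = (-1 : ℂ) ^ (N + 1) • f j := by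
    intro j
    rw [hf, hf, ← relabel_finRotate_det]
    simp only [ofNat_succ_add]
  have hsmul : ∀ (t : ℂ) (g : TensorPoly (N + 2) n) u,
      pairIntegrand (fun i => i) (t • g) u = t * pairIntegrand (fun i => i) g u := by
    intro t g u; simp [pairIntegrand]
  have hcont : ∀ j, Continuous fun v : Fin (N + 1) → ℝ =>
      pairIntegrand (fun i => i) (f j) (Fin.cons 0 v) := fun j =>
    continuous_pairIntegrand_cons (fun i => i) (f j)
  -- The weight g is arbitrary because every step of the induction transfers one rotation from the
  -- tensor to the weight.
  have key : ∀ (j : ℕ) (g : (Fin (N + 1) → ℝ) → ℂ), Continuous g →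
      ∫ v in ordSimplex (N + 1), g v * pairIntegrand (fun i => i) (f j) (Fin.cons 0 v)
        = (-1 : ℂ) ^ ((N + 1) * j) * ∫ v in ordSimplex (N + 1),
          g (rebase^[j] v) * pairIntegrand (fun i => i) (f 0) (Fin.cons 0 v) := by
    intro j
    induction j with
    | zero => intro g _; simp
    | succ j ih =>
      intro g hg
      rw [← setIntegral_comp_rebase (F := fun v => g v *
        pairIntegrand (fun i => i) (f (j + 1)) (Fin.cons 0 v)) (hg.mul (hcont (j + 1)))]
      simp only [pairIntegrand_rebase, hstep, hsmul, mul_left_comm _ ((-1 : ℂ) ^ (N + 1))]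
      rw [MeasureTheory.integral_const_mul, ih (fun v => g (rebase v)) (hg.comp (continuous_rebase N)),
        ← mul_assoc,
        ← pow_add, mul_add, mul_one, add_comm (N + 1)]
      simp only [Function.iterate_succ_apply']
  have hj : ∀ j : Fin (N + 2), (-1 : ℂ) ^ ((N + 1) * (j : ℕ)) * ∫ u in ordSimplex (N + 2),
        pairIntegrand (fun i => i) (diffOp (N + 2) n (slotMatrix (fun i => i) c).det
          (pureTensor (N + 2) n (fun i => b (j + i)))) u
      = ∫ v in ordSimplex (N + 1), ((1 - (rebase^[(j : ℕ)] v) (Fin.last N) : ℝ) : ℂ) *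
          pairIntegrand (fun i => i) (f 0) (Fin.cons 0 v) := by
    intro j
    have e : (diffOp (N + 2) n (slotMatrix (fun i => i) c).det
        (pureTensor (N + 2) n (fun i => b (j + i)))) = f j := by
      rw [hf, show Fin.ofNat (N + 2) (j : ℕ) = j from by ext; simp]
    -- The sign of Connes' operator meets the equal sign from `key`, and their product is 1.
    rw [e, setIntegral_pairIntegrand, key j (fun v => ((1 - v (Fin.last N) : ℝ) : ℂ)) (by fun_prop),
      ← mul_assoc, ← mul_pow]
    simp
  have hgap : ∀ j : ℕ, Continuous fun v : Fin (N + 1) → ℝ =>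
      ((1 - (rebase^[j] v) (Fin.last N) : ℝ) : ℂ) := fun j =>
    Complex.continuous_ofReal.comp (continuous_const.sub
      ((continuous_apply _).comp ((continuous_rebase N).iterate j)))
  simp only [hj]
  rw [← MeasureTheory.integral_finsetSum, pairIntegral_apply]
  swap
  · exact fun j _ => ((hgap (j : ℕ)).mul (hcont 0)).integrableOn_ordSimplex
  refine MeasureTheory.integral_congr_ae (Filter.Eventually.of_forall fun v => ?_)
  simp only
  rw [← Finset.sum_mul, ← Complex.ofReal_sum, sum_rebase_gaps, Complex.ofReal_one, one_mul, hf]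
  simp only [show Fin.ofNat (N + 2) 0 = 0 from by ext; simp, zero_add]

/-! ## The theorem -/

/-- `μ ∫ det (_i∂_x) (a_0 ⊗ ⋯ ⊗ a_{2k+1})`, integrated over the configurations of `2k + 2` points on
the circle with the first point at the base point. -/
noncomputable def baseIntegral (k : ℕ) (b : Fin (2 * k + 2) → MvPolynomial (Fin (2 * (k + 1))) ℂ) :
    ℂ :=
  pairIntegral (fun i : Fin (2 * k + 2) => i) (diffOp (2 * k + 2) (k + 1)
    (slotMatrix (fun i => i) fun l : Fin (2 * k + 2) => (l : Fin (2 * (k + 1)))).det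
    (pureTensor (2 * k + 2) (k + 1) b))

/-- The columns are numbered by `Fin (2 * k + 2)`, which is `Fin (2 * (k + 1))` by definition. This
gives the determinant the shape with a separate column map c that the lemmas on minors require. -/
theorem tauFFS_apply {k : ℕ} {ε : ℤˣ} (a : Fin (2 * k + 3) → Weyl (k + 1) ε) :
    (tauFFS (k + 1) ε).1 a = pairIntegral (fun i : Fin (2 * k + 3) => i)
      (diffOp (2 * k + 3) (k + 1)
        (slotMatrix Fin.succ fun l : Fin (2 * k + 2) => (l : Fin (2 * (k + 1)))).det
        (pureTensor (2 * k + 3) (k + 1) fun i => Weyl.poly (a i))) := by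
  have h : (tauFFS (k + 1) ε).1 a = pairIntegral (fun i : Fin (2 * (k + 1) + 1) => i)
      (detDeriv (k + 1) (pureTensor (2 * (k + 1) + 1) (k + 1) fun i => Weyl.poly (a i))) := rfl
  rw [h, detDeriv_eq_diffOp]
  rfl

theorem pureTensor_cons_one {m n : ℕ} (b : Fin m → MvPolynomial (Fin (2 * n)) ℂ) :
    pureTensor (m + 1) n (Fin.cons 1 b) = relabel n Fin.succ (pureTensor m n b) := by
  have h := pureTensor_insertNth 0 1 b
  rw [map_one, one_mul, Fin.insertNth_zero'] at h
  rw [h, Fin.succAbove_zero]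

theorem diffOp_det_relabel_succ {n N : ℕ} (c : Fin N → Fin (2 * n)) (f : TensorPoly N n) :
    diffOp (N + 1) n (slotMatrix Fin.succ c).det (relabel n Fin.succ f)
      = relabel n Fin.succ (diffOp N n (slotMatrix (fun i => i) c).det f) := by
  rw [← diffOp_relabel (Fin.succ_injective N), relabel_det_slotMatrix]

theorem circlePointsIntegral_eq {k : ℕ} {ε : ℤˣ} (a : Fin (2 * k + 2) → Weyl (k + 1) ε) :
    circlePointsIntegral k ε a = baseIntegral k fun i => Weyl.poly (a i) := by
  have h : circlePointsIntegral k ε a = pairIntegral (N := 2 * k + 1)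
      (fun i : Fin (2 * k + 2) => i.succ) (diffOp (2 * k + 3) (k + 1)
        (slotMatrix Fin.succ fun l : Fin (2 * k + 2) => (l : Fin (2 * (k + 1)))).det
        (pureTensor (2 * k + 3) (k + 1) (Fin.cons 1 fun i => Weyl.poly (a i)))) := by
    rw [circlePointsIntegral, detDeriv_eq_diffOp]
    rfl
  rw [h, pureTensor_cons_one, diffOp_det_relabel_succ, baseIntegral, pairIntegral_apply,
    pairIntegral_apply]
  refine MeasureTheory.integral_congr_ae (Filter.Eventually.of_forall fun u => ?_)
  exact pairIntegrand_relabel (Fin.succ_injective _) (fun i => i) _ _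

/-- The unit in slot 0 carries no variable, so the base point is deleted and the integrand depends
on the other 2k + 2 points alone. -/
theorem tauFFS_unitRotate {k : ℕ} {ε : ℤˣ} (a : Fin (2 * k + 2) → Weyl (k + 1) ε)
    (j : Fin (2 * k + 2)) :
    (tauFFS (k + 1) ε).1 (unitRotate j a) = ∫ u in ordSimplex (2 * k + 2),
      pairIntegrand (fun i => i) (diffOp (2 * k + 2) (k + 1)
        (slotMatrix (fun i => i) fun l : Fin (2 * k + 2) => (l : Fin (2 * (k + 1)))).det
        (pureTensor (2 * k + 2) (k + 1) fun i => Weyl.poly (a (j + i)))) u := by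
  have h : (fun i => Weyl.poly (unitRotate j a i))
      = (Fin.cons 1 fun i => Weyl.poly (a (j + i)) :
        Fin (2 * k + 3) → MvPolynomial (Fin (2 * (k + 1))) ℂ) := by
    funext i
    refine Fin.cases ?_ (fun i => ?_) i <;> rfl
  refine (tauFFS_apply (unitRotate j a)).trans ?_
  rw [h, pureTensor_cons_one, diffOp_det_relabel_succ, pairIntegral_apply]
  refine MeasureTheory.integral_congr_ae (Filter.Eventually.of_forall fun u => ?_)
  simp only
  rw [pairIntegrand_relabel_removeNth (Fin.succ_injective _) (p := 0) (s₀ := fun i => i)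
    (fun i => Fin.zero_succAbove i) (fun q => (Fin.succ_ne_zero q).symm), Fin.removeNth_zero,
    Fin.tail_cons]

theorem connesB_tauFFS {k : ℕ} {ε : ℤˣ} (a : Fin (2 * k + 2) → Weyl (k + 1) ε) :
    (connesB (2 * k + 1) (tauFFS (k + 1) ε)).1 a = circlePointsIntegral k ε a := by
  have h : (connesB (2 * k + 1) (tauFFS (k + 1) ε)).1 a = ∑ j : Fin (2 * k + 2),
      (-1 : ℂ) ^ ((2 * k + 1) * (j : ℕ)) * (tauFFS (k + 1) ε).1 (unitRotate j a) := by
    have e : (connesB (2 * k + 1) (tauFFS (k + 1) ε)).1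
      = connesForm (2 * k + 1) (tauFFS (k + 1) ε).1 := rfl
    rw [e, connesForm]
    simp only [LinearMap.sum_apply, LinearMap.smul_apply, FunLike.coe_sum, Finset.sum_apply,
      FunLike.coe_smul, Pi.smul_apply, pullTuple_apply, smul_eq_mul]
  rw [h, circlePointsIntegral_eq, baseIntegral]
  simp only [tauFFS_unitRotate]
  exact sum_setIntegral_rotate (N := 2 * k) _ fun i => Weyl.poly (a i)

theorem interiorForm_tauFFS {k : ℕ} {ε : ℤˣ} (l : Fin (2 * k + 2))
    (b : Fin (2 * k + 2) → Weyl (k + 1) ε) :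
    interiorForm (2 * k + 1) (Weyl.poly.symm (MvPolynomial.X (l : Fin (2 * (k + 1)))))
        (tauFFS (k + 1) ε).1 b
      = (-1 : ℂ) ^ (l : ℕ) * pairIntegral (fun i : Fin (2 * k + 2) => i)
          (diffOp (2 * k + 2) (k + 1) (slotMatrix Fin.succ
            fun i : Fin (2 * k + 1) => (l.succAbove i : Fin (2 * (k + 1)))).det
            (pureTensor (2 * k + 2) (k + 1) fun i => Weyl.poly (b i))) := by
  refine (interiorForm_apply _ _ _).trans ?_
  refine Eq.trans ?_ (sum_pairIntegral_coord_mul_relabel (n := k + 1) (N := 2 * k + 1)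
    (c := fun l => l) (fun _ _ h => h) l _)
  refine Finset.sum_congr rfl fun j _ => ?_
  congr 1
  refine (tauFFS_apply _).trans ?_
  rw [← pureTensor_insertNth]
  congr 3

theorem LOmega_tauFFS {k : ℕ} {ε : ℤˣ} (a : Fin (2 * k + 2) → Weyl (k + 1) ε) :
    (LOmega (k + 1) ε (2 * k) (tauFFS (k + 1) ε)).1 a
      = -((ε : ℤ) : ℂ) * circlePointsIntegral k ε a := by
  refine (LOmega_apply _ _).trans ?_
  rw [circlePointsIntegral_eq, baseIntegral]
  congr 1
  refine Eq.trans ?_ (sum_pairIntegral_update (n := k + 1) (N := 2 * k + 1) (fun l => l)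
    fun i => Weyl.poly (a i))
  refine Finset.sum_congr rfl fun l _ => Finset.sum_congr rfl fun i _ => ?_
  refine (interiorForm_tauFFS l _).trans ?_
  congr 4

/-- With n = k + 1 the degree 2n reduces by definition to 2k + 2, the form in which `connesB` and
`LOmega` expect it. The last claim follows from the other two because ε² = 1. -/
theorem theorem3p2 (k : ℕ) (ε : ℤˣ) :
    (∀ a : Fin (2 * k + 2) → Weyl (k + 1) ε,
      (connesB (2 * k + 1) (tauFFS (k + 1) ε)).1 a = circlePointsIntegral k ε a) ∧
    (∀ a : Fin (2 * k + 2) → Weyl (k + 1) ε,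
      (LOmega (k + 1) ε (2 * k) (tauFFS (k + 1) ε)).1 a
        = -((ε : ℤ) : ℂ) * circlePointsIntegral k ε a) ∧
    connesB (2 * k + 1) (tauFFS (k + 1) ε)
      + ((ε : ℤ) : ℂ) • LOmega (k + 1) ε (2 * k) (tauFFS (k + 1) ε) = 0 := by
  refine ⟨connesB_tauFFS, LOmega_tauFFS, Subtype.ext (MultilinearMap.ext fun a => ?_)⟩
  have h1 := connesB_tauFFS a
  have h2 := LOmega_tauFFS a
  have hε : ((ε : ℤ) : ℂ) * ((ε : ℤ) : ℂ) = 1 := by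
    rcases Int.units_eq_one_or ε with rfl | rfl <;> simp
  change (connesB (2 * k + 1) (tauFFS (k + 1) ε)).1 a
    + ((ε : ℤ) : ℂ) * (LOmega (k + 1) ε (2 * k) (tauFFS (k + 1) ε)).1 a = 0
  rw [h1, h2]
  linear_combination -(circlePointsIntegral k ε a) * hε
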